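/- Let $g:\mathbb{R}\to\mathbb{R}$ be a twice continuously differentiable $2\pi$-periodic function whose derivative $g'$ has only finitely many zeros in $[0,2\pi)$, and let $0\le a_1<a_2<\dots<a_n<2\pi$ be these zeros. Put $a_{n+1}:=2\pi+a_1$ and $I_j:=(a_j,a_{j+1})$ for $j=1,\dots,n$. On $\mathcal{K}_1:=L^2([0,2\pi],dk/2\pi)$ let $Pf:=-if'$ with domain $$D(P)=\{f \text{ absolutely continuous on } [0,2\pi] : f'\in\mathcal{K}_1,\ f(0)=f(2\pi)\},$$ and for a real function $\varphi$ let $\varphi(k)$ denote the operator of multiplication by $\varphi$ on its domain $\{f\in\mathcal{K}_1:\varphi f\in\mathcal{K}_1\}$. Let $$T:=-\frac12\left(\frac1{g'(k)}P+P\frac1{g'(k)}\right)$$ with its natural domain, i.e. the set of $f\in D(P)$ with $\frac{1}{g'}Pf\in\mathcal{K}_1$ and $\frac{1}{g'}f\in D(P)$. For a compact interval $I=[a,b]$ let $P_I$ be the operator on $L^2(I,dE)$ ($dE$ Lebesgue measure) given by $P_If:=-if'$ with $$D(P_I)=\{f \text{ absolutely continuous on } [a,b] : f'\in L^2(I,dE),\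 f(a)=f(b)=0\}.$$ Write $P_j:=P_{g(\bar I_j)}$ and let $E$ be the operator of multiplication by the variable. For a symmetric operator $A$ let $d_\pm(A):=\dim\ker(A^*\mp i)$ be its deficiency indices. Then $T$ is densely defined and symmetric, hence closable, with closure $\bar T$, and the following hold. (1) There is a unitary operator $V:\mathcal{K}_1\to\bigoplus_{j=1}^n L^2(g(\bar I_j),dE)$ such that, as equalities of operators including domains, $$V\bar TV^{-1}=\bigoplus_{j=1}^n(-P_j),\qquad V g(k)V^{-1}=\bigoplus_{j=1}^n E .$$ (2) $d_+(T)=d_-(T)=n$, the number of zeros of $g'$ in $[0,2\pi)$. In particular, $T$ has a self-adjoint extension. -/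

import Mathlib

open MeasureTheory
open scoped LinearPMap

noncomputable section

namespace TimeOperator

section Abstract

variable {E F : Type*} [NormedAddCommGroup E] [InnerProductSpace ℂ E]
  [NormedAddCommGroup F] [InnerProductSpace ℂ F]

/-- The product `B A` of two partially defined operators on its natural domain
`{x ∈ D(A) | A x ∈ D(B)}`. -/
def opMul (B A : E →ₗ.[ℂ] E) : E →ₗ.[ℂ] E where
  domain :=
    { carrier := {x | ∃ hx : x ∈ A.domain, A ⟨x, hx⟩ ∈ B.domain}
      zero_mem' := ⟨A.domain.zero_mem, by
        have h : A ⟨0, A.domain.zero_mem⟩ = 0 := A.map_zero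
        rw [h]
        exact B.domain.zero_mem⟩
      add_mem' := by
        rintro x y ⟨hx, hx'⟩ ⟨hy, hy'⟩
        have h : A ⟨x + y, A.domain.add_mem hx hy⟩ = A ⟨x, hx⟩ + A ⟨y, hy⟩ :=
          A.map_add ⟨x, hx⟩ ⟨y, hy⟩
        exact ⟨A.domain.add_mem hx hy, h ▸ B.domain.add_mem hx' hy'⟩
      smul_mem' := by
        rintro c x ⟨hx, hx'⟩
        have h : A ⟨c • x, A.domain.smul_mem c hx⟩ = c • A ⟨x, hx⟩ := A.map_smul c ⟨x, hx⟩
        exact ⟨A.domain.smul_mem c hx, h ▸ B.domain.smul_mem c hx'⟩ }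
  toFun :=
    { toFun := fun x => B ⟨A ⟨x, x.2.1⟩, x.2.2⟩
      map_add' := fun x y => by
        rw [← LinearPMap.map_add]
        congr 1
        exact Subtype.ext (A.map_add ⟨x, x.2.1⟩ ⟨y, y.2.1⟩)
      map_smul' := fun c x => by
        rw [RingHom.id_apply, ← LinearPMap.map_smul]
        congr 1
        exact Subtype.ext (A.map_smul c ⟨x, x.2.1⟩) }

/-- The operator `V A V⁻¹` with domain `V D(A)`. -/
def conj (V : E ≃ₗᵢ[ℂ] F) (A : E →ₗ.[ℂ] E) : F →ₗ.[ℂ] F where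
  domain := A.domain.comap (V.symm.toLinearEquiv : F →ₗ[ℂ] E)
  toFun :=
    { toFun := fun y => V (A ⟨V.symm y, y.2⟩)
      map_add' := fun x y => by
        rw [← map_add, ← LinearPMap.map_add]
        congr 2
        ext
        exact map_add V.symm _ _
      map_smul' := fun c x => by
        rw [RingHom.id_apply, ← map_smul, ← LinearPMap.map_smul]
        congr 2
        ext
        exact map_smul V.symm _ _ }

/-- The orthogonal direct sum of finitely many partially defined operators, on the Hilbert
space direct sum and with domain the vectors whose components all lie in the domains. -/
def directSum {ι : Type*} [Fintype ι] {H : ι → Type*} [∀ j, NormedAddCommGroup (H j)]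
    [∀ j, InnerProductSpace ℂ (H j)] (A : ∀ j, H j →ₗ.[ℂ] H j) :
    PiLp 2 H →ₗ.[ℂ] PiLp 2 H where
  domain :=
    { carrier := {x | ∀ j, x j ∈ (A j).domain}
      zero_mem' := fun j => (A j).domain.zero_mem
      add_mem' := fun hx hy j => (A j).domain.add_mem (hx j) (hy j)
      smul_mem' := fun c _ hx j => (A j).domain.smul_mem c (hx j) }
  toFun :=
    { toFun := fun x => WithLp.toLp 2 fun j => A j ⟨(x : PiLp 2 H) j, x.2 j⟩
      map_add' := fun x y => by
        ext j
        exact (A j).map_add ⟨(x : PiLp 2 H) j, x.2 j⟩ ⟨(y : PiLp 2 H) j, y.2 j⟩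
      map_smul' := fun c x => by
        ext j
        exact (A j).map_smul c ⟨(x : PiLp 2 H) j, x.2 j⟩ }

/-- A partially defined operator is symmetric if it is densely defined and contained in its
adjoint. -/
def IsSymmetricOp [CompleteSpace E] (A : E →ₗ.[ℂ] E) : Prop :=
  Dense (A.domain : Set E) ∧ A ≤ A†

/-- The kernel of `A - z`, as a subspace of the whole space. -/
def kerSub (A : E →ₗ.[ℂ] E) (z : ℂ) : Submodule ℂ E where
  carrier := {x | ∃ hx : x ∈ A.domain, A ⟨x, hx⟩ = z • x}
  zero_mem' := ⟨A.domain.zero_mem, by rw [smul_zero]; exact A.map_zero⟩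
  add_mem' := by
    rintro x y ⟨hx, hx'⟩ ⟨hy, hy'⟩
    refine ⟨A.domain.add_mem hx hy, ?_⟩
    rw [smul_add, ← hx', ← hy', ← LinearPMap.map_add]
    rfl
  smul_mem' := by
    rintro c x ⟨hx, hx'⟩
    refine ⟨A.domain.smul_mem c hx, ?_⟩
    rw [smul_comm, ← hx', ← LinearPMap.map_smul]
    rfl

/-- The deficiency index `d₊(A) = dim ker (A* - i)`, as a cardinal. -/
def deficiencyPlus [CompleteSpace E] (A : E →ₗ.[ℂ] E) : Cardinal :=
  Module.rank ℂ (kerSub A† Complex.I)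

/-- The deficiency index `d₋(A) = dim ker (A* + i)`, as a cardinal. -/
def deficiencyMinus [CompleteSpace E] (A : E →ₗ.[ℂ] E) : Cardinal :=
  Module.rank ℂ (kerSub A† (-Complex.I))

end Abstract

/-- Multiplication by the real function `φ` on `L²(μ)`, with its natural domain
`{f ∈ L²(μ) | φ f ∈ L²(μ)}`. -/
def mulOp (μ : Measure ℝ) (φ : ℝ → ℝ) : Lp ℂ 2 μ →ₗ.[ℂ] Lp ℂ 2 μ where
  domain :=
    { carrier := {f | MemLp (fun x => (φ x : ℂ) * f x) 2 μ}
      zero_mem' := by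
        refine (MemLp.zero (ε := ℂ)).ae_eq ?_
        filter_upwards [Lp.coeFn_zero ℂ 2 μ] with x hx
        simp only [hx, Pi.zero_apply, mul_zero]
      add_mem' := by
        intro f h hf hh
        refine (MemLp.add hf hh).ae_eq ?_
        filter_upwards [Lp.coeFn_add f h] with x hx
        simp only [hx, Pi.add_apply, mul_add]
      smul_mem' := by
        intro c f hf
        refine (MemLp.const_smul hf c).ae_eq ?_
        filter_upwards [Lp.coeFn_smul c f] with x hx
        simp only [hx, Pi.smul_apply, smul_eq_mul]
        ring }
  toFun :=
    { toFun := fun f => MemLp.toLp _ f.2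
      map_add' := fun f h => by
        apply Lp.ext
        refine (MemLp.coeFn_toLp _).trans (.trans ?_ (Lp.coeFn_add _ _).symm)
        filter_upwards [Lp.coeFn_add (f : Lp ℂ 2 μ) h, MemLp.coeFn_toLp f.2,
          MemLp.coeFn_toLp h.2] with x h1 h2 h3
        simp only [Submodule.coe_add, Pi.add_apply, h1, h2, h3, mul_add]
      map_smul' := fun c f => by
        apply Lp.ext
        refine (MemLp.coeFn_toLp _).trans (.trans ?_ (Lp.coeFn_smul _ _).symm)
        filter_upwards [Lp.coeFn_smul c (f : Lp ℂ 2 μ), MemLp.coeFn_toLp f.2] with x h1 h2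
        simp only [RingHom.id_apply, Submodule.coe_smul, h1, h2, Pi.smul_apply, smul_eq_mul]
        ring }

/-- The pairs `(f, -i f')` in `L²(μ) × L²(μ)`, where `f` (has a representative which) is absolutely
continuous on `[a, b]`, satisfies the linear boundary condition `(f a, f b) ∈ B`, and has its
almost everywhere defined derivative in `L²(μ)`. The derivative is expressed by
`h = -i f'`, that is `f' = i h`. -/
def momentumGraph (μ : Measure ℝ) (a b : ℝ) (B : Submodule ℂ (ℂ × ℂ)) :
    Submodule ℂ (Lp ℂ 2 μ × Lp ℂ 2 μ) where
  carrier := {p | ∃ f : ℝ → ℂ, AbsolutelyContinuousOnInterval f a b ∧ (f a, f b) ∈ B ∧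
    p.1 =ᵐ[μ] f ∧ ∀ᵐ x ∂μ, HasDerivAt f (Complex.I * p.2 x) x}
  zero_mem' := by
    refine ⟨fun _ => 0, ?_, B.zero_mem, Lp.coeFn_zero ℂ 2 μ, ?_⟩
    · simpa [AbsolutelyContinuousOnInterval] using tendsto_const_nhds
    · filter_upwards [Lp.coeFn_zero ℂ 2 μ] with x hx
      have : Complex.I * (0 : Lp ℂ 2 μ) x = 0 := by
        rw [hx, Pi.zero_apply, mul_zero]
      exact this ▸ hasDerivAt_const x (0 : ℂ)
  add_mem' := by
    rintro ⟨p1, p2⟩ ⟨q1, q2⟩ ⟨f, hf, hfB, hf1, hf2⟩ ⟨h, hh, hhB, hh1, hh2⟩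
    refine ⟨f + h, hf.add hh, B.add_mem hfB hhB, (Lp.coeFn_add _ _).trans (hf1.add hh1), ?_⟩
    filter_upwards [hf2, hh2, Lp.coeFn_add p2 q2] with x h1 h2 h3
    have h4 : Complex.I * (p2 + q2) x = Complex.I * p2 x + Complex.I * q2 x := by
      rw [h3, Pi.add_apply, mul_add]
    exact h4 ▸ h1.add h2
  smul_mem' := by
    rintro c ⟨p1, p2⟩ ⟨f, hf, hfB, hf1, hf2⟩
    refine ⟨fun x => c • f x, hf.const_smul c, B.smul_mem c hfB,
      (Lp.coeFn_smul _ _).trans (hf1.const_smul c), ?_⟩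
    filter_upwards [hf2, Lp.coeFn_smul c p2] with x h1 h2
    have h4 : Complex.I * (c • p2) x = c • (Complex.I * p2 x) := by
      rw [h2, Pi.smul_apply, smul_eq_mul, smul_eq_mul]
      ring
    exact h4 ▸ h1.const_smul c

/-- The operator `-i d/dx` on `L²(μ)`, on absolutely continuous functions on `[a, b]` with
square-integrable derivative and boundary condition `(f a, f b) ∈ B`. -/
def momentum (μ : Measure ℝ) (a b : ℝ) (B : Submodule ℂ (ℂ × ℂ)) : Lp ℂ 2 μ →ₗ.[ℂ] Lp ℂ 2 μ :=
  (momentumGraph μ a b B).toLinearPMap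

/-- If `μ` has the same null sets as Lebesgue measure on `[a, b]`, then `momentumGraph` is the
graph of an operator. -/
theorem momentum_graph_eq (μ : Measure ℝ) (a b : ℝ) (B : Submodule ℂ (ℂ × ℂ)) (hab : a ≤ b)
    (h1 : μ ≪ volume.restrict (Set.Icc a b)) (h2 : volume.restrict (Set.Icc a b) ≪ μ) :
    (momentum μ a b B).graph = momentumGraph μ a b B := by
  apply Submodule.toLinearPMap_graph_eq
  rintro ⟨p1, p2⟩ ⟨f, hf, -, hf1, hf2⟩ (rfl : p1 = 0)
  have hmem : ∀ᵐ x ∂μ, x ∈ Set.Ioo a b := by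
    apply h1.ae_le
    rw [← Measure.restrict_congr_set Ioo_ae_eq_Icc]
    exact ae_restrict_mem measurableSet_Ioo
  have hz : ∀ x ∈ Set.Ioo a b, f x = 0 := by
    have hc : ContinuousOn f (Set.Ioo a b) :=
      hf.continuousOn.mono (by rw [Set.uIcc_of_le hab]; exact Set.Ioo_subset_Icc_self)
    have h0 : f =ᵐ[volume.restrict (Set.Ioo a b)] fun _ => 0 := by
      rw [Measure.restrict_congr_set Ioo_ae_eq_Icc]
      exact h2.ae_le (hf1.symm.trans (Lp.coeFn_zero ℂ 2 μ))
    exact Measure.eqOn_open_of_ae_eq h0 isOpen_Ioo hc continuousOn_const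
  apply Lp.ext
  filter_upwards [hf2, hmem, Lp.coeFn_zero ℂ 2 μ] with x hx hxm h0
  have hd : HasDerivAt f 0 x := by
    refine (hasDerivAt_const x (0 : ℂ)).congr_of_eventuallyEq ?_
    filter_upwards [isOpen_Ioo.mem_nhds hxm] with y hy using hz y hy
  have := hx.unique hd
  rw [h0]
  simpa using this

/-- The measure `dk / 2π` on `[0, 2π]`. -/
def circleMeasure : Measure ℝ :=
  ENNReal.ofReal (1 / (2 * Real.pi)) • volume.restrict (Set.Icc 0 (2 * Real.pi))

/-- The Hilbert space `L²([0, 2π], dk / 2π)`. -/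
abbrev CircleL2 : Type := Lp ℂ 2 circleMeasure

/-- The operator `P = -i d/dk` on `L²([0, 2π], dk / 2π)` with periodic boundary condition
`f 0 = f (2π)`. -/
def periodicMomentum : CircleL2 →ₗ.[ℂ] CircleL2 :=
  momentum circleMeasure 0 (2 * Real.pi)
    (LinearMap.eqLocus (LinearMap.fst ℂ ℂ ℂ) (LinearMap.snd ℂ ℂ ℂ))

/-- The Hilbert space `L²(I, dE)`, where `dE` is Lebesgue measure. -/
abbrev IntervalL2 (I : Set ℝ) : Type := Lp ℂ 2 (volume.restrict I)

/-- For a compact interval `I = [a, b]`, the operator `P_I = -i d/dE` on `L²(I, dE)` with boundary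
condition `f a = f b = 0`; the end points are `a = sInf I` and `b = sSup I`. -/
def dirichletMomentum (I : Set ℝ) : IntervalL2 I →ₗ.[ℂ] IntervalL2 I :=
  momentum (volume.restrict I) (sInf I) (sSup I) ⊥

theorem circleMeasure_ac :
    circleMeasure ≪ volume.restrict (Set.Icc 0 (2 * Real.pi)) ∧
      volume.restrict (Set.Icc 0 (2 * Real.pi)) ≪ circleMeasure :=
  ⟨Measure.smul_absolutelyContinuous, Measure.absolutelyContinuous_smul (by
    rw [Ne, ENNReal.ofReal_eq_zero, not_le]
    positivity)⟩

theorem mem_periodicMomentum_graph (p : CircleL2 × CircleL2) :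
    p ∈ periodicMomentum.graph ↔ ∃ f : ℝ → ℂ,
      AbsolutelyContinuousOnInterval f 0 (2 * Real.pi) ∧ f 0 = f (2 * Real.pi) ∧
      p.1 =ᵐ[circleMeasure] f ∧
      ∀ᵐ x ∂circleMeasure, HasDerivAt f (Complex.I * p.2 x) x := by
  rw [periodicMomentum, momentum_graph_eq _ _ _ _ (by positivity) circleMeasure_ac.1
    circleMeasure_ac.2]
  rfl

theorem mem_dirichletMomentum_graph {a b : ℝ} (hab : a ≤ b)
    (p : IntervalL2 (Set.Icc a b) × IntervalL2 (Set.Icc a b)) :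
    p ∈ (dirichletMomentum (Set.Icc a b)).graph ↔ ∃ f : ℝ → ℂ,
      AbsolutelyContinuousOnInterval f a b ∧ (f a = 0 ∧ f b = 0) ∧
      p.1 =ᵐ[volume.restrict (Set.Icc a b)] f ∧
      ∀ᵐ x ∂volume.restrict (Set.Icc a b), HasDerivAt f (Complex.I * p.2 x) x := by
  rw [dirichletMomentum, csInf_Icc hab, csSup_Icc hab,
    momentum_graph_eq _ _ _ _ hab Measure.AbsolutelyContinuous.rfl
      Measure.AbsolutelyContinuous.rfl]
  simp only [← Prod.mk_eq_zero]
  rfl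

/-- The operator `T = -(1/2) ((1/g') P + P (1/g'))` on `L²([0, 2π], dk / 2π)`, with its natural
domain. -/
def timeOp (g : ℝ → ℝ) : CircleL2 →ₗ.[ℂ] CircleL2 :=
  (-(1 / 2) : ℂ) •
    (opMul (mulOp circleMeasure fun k => 1 / deriv g k) periodicMomentum +
      opMul periodicMomentum (mulOp circleMeasure fun k => 1 / deriv g k))

/-- For points `a₁ < ... < aₙ` of `[0, 2π)`, the successor of the `j`-th one on the circle:
`a_{j+1}` for `j < n`, and `2π + a₁` for `j = n`. -/
def nextZero {n : ℕ} (a : Fin n → ℝ) (j : Fin n) : ℝ :=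
  if h : (j : ℕ) + 1 < n then a ⟨j + 1, h⟩ else 2 * Real.pi + a ⟨0, j.pos⟩

/-- The set `g([a_j, a_{j+1}])`. -/
def energyInterval (g : ℝ → ℝ) {n : ℕ} (a : Fin n → ℝ) (j : Fin n) : Set ℝ :=
  g '' Set.Icc (a j) (nextZero a j)

end TimeOperator

end

/-!
# The time operator of a one-dimensional periodic band function

On an open arc `(a_j, a_{j+1})` between consecutive critical points the band function `g` is
strictly monotone with nonvanishing derivative, so that it may be used as a coordinate there. The
substitution `E = g k`, together with the square root of its Jacobian, is the unitary
`(W u) k = √(2π |g' k|) u_j (g k)` (for `k` in the `j`-th arc, reduced modulo `2π`) from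
`⨁ L²(g [a_j, a_{j+1}])` onto `L²([0, 2π], dk / 2π)`. It carries multiplication by `E` to
multiplication by `g`, and formally `-i d/dE` to `(1/2) ((1/g') P + P (1/g'))`.

For the domains, let `A = ⨁ (-P_j)` be the direct sum with Dirichlet conditions.

* `CriticalPoints.graph_timeOp_subset`: the graph of `T` lies in the image under `W` of the graph
  of `A`. If `f` is in the domain of `T`, then `f = g' F` with `F` absolutely continuous and
  periodic, so in the energy variable `f` becomes `u = f / √(2π|g'|) = ± √(|g'| / 2π) F`, which is
  continuous and vanishes at the critical points: the boundary conditions are automatic. Between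
  them `u` is locally absolutely continuous with the square-integrable derivative prescribed by
  `T f`, so it is absolutely continuous on the whole energy interval.
* `CriticalPoints.graph_timeOp_of_test`: conversely `W` maps continuously differentiable functions
  with compact support inside one of the open intervals into the domain of `T`. Such functions form
  a core for `A` (`graph_subset_closure_testGraph`), because the Volterra operator is continuous on
  `L²` and a function of mean zero is a limit of test functions of mean zero.

Since `A` is closed, the closure of the graph of `T` is exactly the image of the graph of `A`
(`CriticalPoints.mem_closure_graph_timeOp_iff`), which gives the unitary equivalence. Replacing
Dirichlet by periodic conditions on each interval enlarges `A` to an operator `B`, which is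
self-adjoint because it is symmetric and `B ± i` are onto, as one sees by solving a first-order
linear equation (`CriticalPoints.basicCriterion`); hence `T` is symmetric and closable and has a
self-adjoint extension. Finally the kernel of `T* ∓ i` corresponds to the kernel of `A* ∓ i`, which
is spanned by the functions `e^{± E}` on the individual intervals, so both deficiency indices equal
the number of arcs (`CriticalPoints.rank_kerSub_adjoint_timeOp`).
-/

namespace TimeOperator

open Set Filter Topology
open scoped InnerProductSpace

/-! ### Absolutely continuous functions and indefinite integrals -/

theorem _root_.AbsolutelyContinuousOnInterval.isometry_comp {X Y : Type*} [PseudoMetricSpace X]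
    [PseudoMetricSpace Y] {f : ℝ → X} {a b : ℝ} {e : X → Y} (he : Isometry e)
    (hf : AbsolutelyContinuousOnInterval f a b) :
    AbsolutelyContinuousOnInterval (fun x => e (f x)) a b := by
  rw [absolutelyContinuousOnInterval_iff] at hf ⊢
  simpa only [he.dist_eq] using hf

theorem _root_.AbsolutelyContinuousOnInterval.congr {X : Type*} [PseudoMetricSpace X]
    {f h : ℝ → X} {a b : ℝ}
    (hf : AbsolutelyContinuousOnInterval f a b) (hfh : ∀ x ∈ uIcc a b, h x = f x) :
    AbsolutelyContinuousOnInterval h a b := by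
  rw [absolutelyContinuousOnInterval_iff] at hf ⊢
  intro ε hε
  obtain ⟨δ, hδ, H⟩ := hf ε hε
  refine ⟨δ, hδ, fun E hE hEδ => lt_of_le_of_lt (le_of_eq ?_) (H E hE hEδ)⟩
  refine Finset.sum_congr rfl fun i hi => ?_
  rw [hfh _ (hE.1 i hi).1, hfh _ (hE.1 i hi).2]

theorem absolutelyContinuousOnInterval_intervalIntegral {φ : ℝ → ℂ} {a b c : ℝ}
    (h : IntervalIntegrable φ volume a b) (hc : c ∈ uIcc a b) :
    AbsolutelyContinuousOnInterval (fun x => ∫ v in c..x, φ v) a b := by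
  have hre : IntervalIntegrable (fun x => (φ x).re) volume a b := ⟨h.1.re, h.2.re⟩
  have him : IntervalIntegrable (fun x => (φ x).im) volume a b := ⟨h.1.im, h.2.im⟩
  have h1 := AbsolutelyContinuousOnInterval.isometry_comp Complex.isometry_ofReal
    (hre.absolutelyContinuousOnInterval_intervalIntegral hc)
  have h2 := (AbsolutelyContinuousOnInterval.isometry_comp Complex.isometry_ofReal
    (him.absolutelyContinuousOnInterval_intervalIntegral hc)).const_smul Complex.I
  refine (h1.add h2).congr fun x hx => ?_
  have hi : IntervalIntegrable φ volume c x := h.mono_set (uIcc_subset_uIcc hc hx)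
  have hire : IntervalIntegrable (fun x => ((φ x).re : ℂ)) volume c x :=
    ⟨hi.1.re.ofReal, hi.2.re.ofReal⟩
  have hiim : IntervalIntegrable (fun x => Complex.I • ((φ x).im : ℂ)) volume c x :=
    ⟨hi.1.im.ofReal.smul Complex.I, hi.2.im.ofReal.smul Complex.I⟩
  simp only [Pi.add_apply]
  rw [← intervalIntegral.integral_ofReal, ← intervalIntegral.integral_ofReal,
    ← intervalIntegral.integral_smul, ← intervalIntegral.integral_add hire hiim]
  refine intervalIntegral.integral_congr fun v _ => ?_
  simp only [smul_eq_mul]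
  rw [mul_comm, Complex.re_add_im]

theorem _root_.AbsolutelyContinuousOnInterval.eq_add_intervalIntegral {f φ : ℝ → ℂ} {a b : ℝ}
    (hab : a ≤ b) (hf : AbsolutelyContinuousOnInterval f a b)
    (hφ : IntervalIntegrable φ volume a b) (h : ∀ᵐ x, x ∈ Icc a b → HasDerivAt f (φ x) x)
    {x : ℝ} (hx : x ∈ Icc a b) : f x = f a + ∫ t in a..x, φ t := by
  have hac := hf.sub (absolutelyContinuousOnInterval_intervalIntegral hφ left_mem_uIcc)
  obtain ⟨C, hC⟩ := hac.const_of_ae_hasDerivAt_zero (by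
    filter_upwards [h, hφ.ae_hasDerivAt_integral] with x h1 h2 hx
    have := (h1 (by rwa [uIcc_of_le hab] at hx)).sub (h2 hx a left_mem_uIcc)
    rwa [sub_self] at this)
  have h1 := hC x (by rwa [uIcc_of_le hab])
  have h2 := hC a left_mem_uIcc
  simp only [Pi.sub_apply, intervalIntegral.integral_same, sub_zero] at h1 h2
  rw [h2, ← h1]; ring

theorem absolutelyContinuousOnInterval_of_contDiff {f : ℝ → ℂ} (hf : ContDiff ℝ 1 f) (a b : ℝ) :
    AbsolutelyContinuousOnInterval f a b :=
  hf.contDiffOn.absolutelyContinuousOnInterval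

/-! ### First-order equations on an interval -/

theorem intervalIntegrable_of_Lp {m M : ℝ} (hmM : m ≤ M) (w : IntervalL2 (Icc m M)) :
    IntervalIntegrable w volume m M := by
  rw [intervalIntegrable_iff_integrableOn_Icc_of_le hmM]
  exact (Lp.memLp w).integrable (by norm_num)

theorem hasDerivAt_cexp_mul (c : ℂ) (x : ℝ) :
    HasDerivAt (fun x : ℝ => Complex.exp (c * x)) (Complex.exp (c * x) * c) x := by
  have h := ((Complex.ofRealCLM.hasDerivAt (x := x)).const_mul c).cexp
  simpa using h

theorem contDiff_cexp_mul (c : ℂ) : ContDiff ℝ 1 (fun x : ℝ => Complex.exp (c * x)) :=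
  (contDiff_const.mul Complex.ofRealCLM.contDiff).cexp

/-- Variation of constants: a solution of `f' + c f = w` is determined by its initial value. -/
theorem integral_exp_mul_eq {m M : ℝ} (hmM : m ≤ M) {c : ℂ} {f w : ℝ → ℂ}
    (hf : AbsolutelyContinuousOnInterval f m M) (hw : IntervalIntegrable w volume m M)
    (h : ∀ᵐ x, x ∈ Icc m M → HasDerivAt f (w x - c * f x) x) {x : ℝ} (hx : x ∈ Icc m M) :
    Complex.exp (c * x) * f x =
      Complex.exp (c * m) * f m + ∫ s in m..x, Complex.exp (c * s) * w s := by
  have hc := contDiff_cexp_mul c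
  have hac : AbsolutelyContinuousOnInterval (fun x : ℝ => Complex.exp (c * x) * f x) m M := by
    simpa using! (absolutelyContinuousOnInterval_of_contDiff hc m M).smul hf
  refine hac.eq_add_intervalIntegral hmM (hw.continuousOn_mul hc.continuous.continuousOn) ?_ hx
  filter_upwards [h] with x hx hxm
  refine ((hasDerivAt_cexp_mul c x).mul (hx hxm)).congr_deriv ?_
  ring

/-- Variation of constants: solvability of `f' + c f = w` with prescribed initial value. -/
theorem exists_ode_solution {m M : ℝ} (hmM : m ≤ M) (c y : ℂ) {w : ℝ → ℂ}
    (hw : IntervalIntegrable w volume m M) :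
    ∃ f : ℝ → ℂ, AbsolutelyContinuousOnInterval f m M ∧
      Complex.exp (c * m) * f m = y ∧
      Complex.exp (c * M) * f M = y + ∫ s in m..M, Complex.exp (c * s) * w s ∧
      ∀ᵐ x, x ∈ Icc m M → HasDerivAt f (w x - c * f x) x := by
  have hw' := hw.continuousOn_mul (contDiff_cexp_mul c).continuous.continuousOn
  have hcc : ∀ x : ℝ, Complex.exp (c * x) * Complex.exp (-c * x) = 1 := fun x => by
    rw [← Complex.exp_add]; simp
  refine ⟨fun x => Complex.exp (-c * x) * (y + ∫ s in m..x, Complex.exp (c * s) * w s),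
    ?_, ?_, ?_, ?_⟩
  · have h1 := absolutelyContinuousOnInterval_of_contDiff
      (contDiff_const (c := y) (n := 1) (𝕜 := ℝ) (E := ℝ)) m M
    simpa using! (absolutelyContinuousOnInterval_of_contDiff (contDiff_cexp_mul (-c)) m M).smul
      (h1.add (absolutelyContinuousOnInterval_intervalIntegral hw' left_mem_uIcc))
  · rw [← mul_assoc, hcc]; simp
  · rw [← mul_assoc, hcc]; simp
  · filter_upwards [hw'.ae_hasDerivAt_integral] with x hx hxm
    rw [← uIcc_of_le hmM] at hxm
    refine ((hasDerivAt_cexp_mul (-c) x).mul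
      ((hx hxm m left_mem_uIcc).const_add y)).congr_deriv ?_
    linear_combination w x * hcc x

theorem memLp_of_continuousOn {m M : ℝ} {f : ℝ → ℂ} (hf : ContinuousOn f (Icc m M)) :
    MemLp f 2 (volume.restrict (Icc m M)) := by
  obtain ⟨C, hC⟩ := isCompact_Icc.exists_bound_of_continuousOn hf
  exact MemLp.of_bound (hf.aestronglyMeasurable measurableSet_Icc) C
    ((ae_restrict_iff' measurableSet_Icc).2 (ae_of_all _ hC))

theorem _root_.AbsolutelyContinuousOnInterval.memLp {m M : ℝ} (hmM : m ≤ M) {f : ℝ → ℂ}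
    (hf : AbsolutelyContinuousOnInterval f m M) : MemLp f 2 (volume.restrict (Icc m M)) :=
  memLp_of_continuousOn (by simpa [uIcc_of_le hmM] using hf.continuousOn)

/-! ### Graphs of partially defined operators -/

section Abstract

variable {E F : Type*} [NormedAddCommGroup E] [InnerProductSpace ℂ E]
  [NormedAddCommGroup F] [InnerProductSpace ℂ F]

theorem mem_graph_neg {A : E →ₗ.[ℂ] E} {p : E × E} :
    p ∈ (-A).graph ↔ (p.1, -p.2) ∈ A.graph := by
  simp only [LinearPMap.mem_graph_iff, LinearPMap.neg_apply]
  constructor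
  · rintro ⟨y, hy, h⟩
    exact ⟨y, hy, by rw [← h, neg_neg]⟩
  · rintro ⟨y, hy, h⟩
    exact ⟨y, hy, by rw [h, neg_neg]⟩

theorem mem_graph_conj {V : E ≃ₗᵢ[ℂ] F} {A : E →ₗ.[ℂ] E} {p : F × F} :
    p ∈ (conj V A).graph ↔ (V.symm p.1, V.symm p.2) ∈ A.graph := by
  simp only [LinearPMap.mem_graph_iff]
  constructor
  · rintro ⟨y, hy, h⟩
    refine ⟨⟨V.symm y, y.2⟩, by rw [← hy], ?_⟩
    rw [← h]
    exact (V.symm_apply_apply _).symm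
  · rintro ⟨y, hy, h⟩
    have hm : V.symm p.1 ∈ A.domain := hy ▸ y.2
    refine ⟨⟨p.1, hm⟩, rfl, ?_⟩
    have : y = ⟨V.symm p.1, hm⟩ := Subtype.ext hy
    rw [this] at h
    change V (A ⟨V.symm p.1, hm⟩) = p.2
    rw [h, V.apply_symm_apply]

theorem mem_graph_directSum {ι : Type*} [Fintype ι] {H : ι → Type*}
    [∀ j, NormedAddCommGroup (H j)] [∀ j, InnerProductSpace ℂ (H j)] {A : ∀ j, H j →ₗ.[ℂ] H j}
    {p : PiLp 2 H × PiLp 2 H} :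
    p ∈ (directSum A).graph ↔ ∀ j, (p.1 j, p.2 j) ∈ (A j).graph := by
  simp only [LinearPMap.mem_graph_iff]
  constructor
  · rintro ⟨y, hy, h⟩ j
    refine ⟨⟨(y : PiLp 2 H) j, y.2 j⟩, by rw [← hy], ?_⟩
    rw [← h]
    rfl
  · intro h
    choose y hy h using h
    have hm : ∀ j, p.1 j ∈ (A j).domain := fun j => hy j ▸ (y j).2
    refine ⟨⟨p.1, hm⟩, rfl, ?_⟩
    ext j
    have : y j = ⟨p.1 j, hm j⟩ := Subtype.ext (hy j)
    rw [← h j, this]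
    rfl

/-- The basic criterion for self-adjointness: `A` is symmetric and `A + i`, `A - i` are onto.
Density of the domain is a consequence and need not be assumed. -/
structure SatisfiesBasicCriterion (A : E →ₗ.[ℂ] E) : Prop where
  symm : ∀ p ∈ A.graph, ∀ q ∈ A.graph, ⟪p.2, q.1⟫_ℂ = ⟪p.1, q.2⟫_ℂ
  add_surj : ∀ w, ∃ p ∈ A.graph, p.2 + Complex.I • p.1 = w
  sub_surj : ∀ w, ∃ p ∈ A.graph, p.2 - Complex.I • p.1 = w

theorem SatisfiesBasicCriterion.conj {A : E →ₗ.[ℂ] E} (hA : SatisfiesBasicCriterion A)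
    (V : E ≃ₗᵢ[ℂ] F) : SatisfiesBasicCriterion (conj V A) where
  symm p hp q hq := by
    simpa using hA.symm _ (mem_graph_conj.1 hp) _ (mem_graph_conj.1 hq)
  add_surj w := by
    obtain ⟨p, hp, h⟩ := hA.add_surj (V.symm w)
    refine ⟨(V p.1, V p.2), mem_graph_conj.2 (by simpa using hp), ?_⟩
    rw [← map_smul, ← map_add, h, V.apply_symm_apply]
  sub_surj w := by
    obtain ⟨p, hp, h⟩ := hA.sub_surj (V.symm w)
    refine ⟨(V p.1, V p.2), mem_graph_conj.2 (by simpa using hp), ?_⟩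
    rw [← map_smul, ← map_sub, h, V.apply_symm_apply]

theorem SatisfiesBasicCriterion.directSum {ι : Type*} [Fintype ι] {H : ι → Type*}
    [∀ j, NormedAddCommGroup (H j)] [∀ j, InnerProductSpace ℂ (H j)] {A : ∀ j, H j →ₗ.[ℂ] H j}
    (hA : ∀ j, SatisfiesBasicCriterion (A j)) : SatisfiesBasicCriterion (directSum A) where
  symm p hp q hq := by
    rw [PiLp.inner_apply, PiLp.inner_apply]
    exact Finset.sum_congr rfl fun j _ =>
      (hA j).symm _ (mem_graph_directSum.1 hp j) _ (mem_graph_directSum.1 hq j)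
  add_surj w := by
    choose p hp h using fun j => (hA j).add_surj (w j)
    refine ⟨(WithLp.toLp 2 fun j => (p j).1, WithLp.toLp 2 fun j => (p j).2),
      mem_graph_directSum.2 hp, ?_⟩
    ext j
    simpa using h j
  sub_surj w := by
    choose p hp h using fun j => (hA j).sub_surj (w j)
    refine ⟨(WithLp.toLp 2 fun j => (p j).1, WithLp.toLp 2 fun j => (p j).2),
      mem_graph_directSum.2 hp, ?_⟩
    ext j
    simpa using h j

variable [CompleteSpace E]

theorem SatisfiesBasicCriterion.dense {A : E →ₗ.[ℂ] E} (hA : SatisfiesBasicCriterion A) :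
    Dense (A.domain : Set E) := by
  rw [Submodule.dense_iff_topologicalClosure_eq_top, Submodule.topologicalClosure_eq_top_iff,
    Submodule.eq_bot_iff]
  intro x hx
  obtain ⟨p, hp, rfl⟩ := hA.add_surj x
  have h0 := (Submodule.mem_orthogonal _ _).1 hx p.1 (LinearPMap.mem_domain_of_mem_graph hp)
  rw [inner_add_right, inner_smul_right, inner_self_eq_norm_sq_to_K] at h0
  -- `⟪p.1, p.2⟫` is real by symmetry, so only `i ‖p.1‖²` contributes to the imaginary part.
  have him : (⟪p.1, p.2⟫_ℂ).im = 0 := by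
    have h1 := hA.symm p hp p hp
    rw [← inner_conj_symm] at h1
    have h2 := congrArg Complex.im h1
    rw [Complex.conj_im] at h2
    linarith
  have h1 := congrArg Complex.im h0
  have h2 : p.1 = 0 := by
    rw [Complex.add_im, him] at h1
    simpa [← Complex.ofReal_pow] using h1
  have h3 : p.2 = 0 := A.graph_fst_eq_zero_snd (x := p.1) (x' := p.2) hp h2
  rw [h2, h3, smul_zero, add_zero]

/-- If `(x, y)` is in the graph of the adjoint, subtract the graph element on which `A - i` takes
the value `y - i x`; the difference is orthogonal to the range of `A + i`, hence zero. -/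
theorem SatisfiesBasicCriterion.isSelfAdjoint {A : E →ₗ.[ℂ] E} (hA : SatisfiesBasicCriterion A) :
    IsSelfAdjoint A := by
  rw [LinearPMap.isSelfAdjoint_def]
  have hd := hA.dense
  apply LinearPMap.eq_of_eq_graph
  rw [LinearPMap.adjoint_graph_eq_graph_adjoint hd]
  ext ⟨x, y⟩
  rw [Submodule.mem_adjoint_iff]
  constructor
  · intro h
    obtain ⟨p, hp, hpw⟩ := hA.sub_surj (y - Complex.I • x)
    have hy : y - p.2 = Complex.I • (x - p.1) := by
      have : y = p.2 - Complex.I • p.1 + Complex.I • x := by rw [hpw]; abel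
      rw [this, smul_sub]; abel
    have hd0 : x - p.1 = 0 := by
      obtain ⟨q, hq, hqw⟩ := hA.add_surj (x - p.1)
      have h1 := h q.1 q.2 hq
      have h2 := hA.symm q hq p hp
      have h3 : ⟪q.2 + Complex.I • q.1, x - p.1⟫_ℂ = 0 := by
        have h4 : ⟪q.1, y - p.2⟫_ℂ = Complex.I * ⟪q.1, x - p.1⟫_ℂ := by
          rw [hy, inner_smul_right]
        rw [inner_sub_right] at h4
        rw [inner_add_left, inner_smul_left, Complex.conj_I, inner_sub_right q.2]
        simp only at h1
        linear_combination h1 - h2 + h4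
      rwa [hqw, inner_self_eq_zero] at h3
    have h1 : x = p.1 := sub_eq_zero.1 hd0
    rw [hd0, smul_zero, sub_eq_zero] at hy
    rw [h1, hy]
    exact hp
  · intro h a b hab
    exact sub_eq_zero.2 (hA.symm (a, b) hab (x, y) h)

/-- The kernel of `A* - z`, expressed by the closure of the graph of `A`. -/
theorem mem_kerSub_adjoint_iff {A : E →ₗ.[ℂ] E} (hd : Dense (A.domain : Set E)) {x : E} {z : ℂ} :
    x ∈ kerSub A† z ↔ ∀ p ∈ A.graph.topologicalClosure, ⟪x, p.2⟫_ℂ = ⟪z • x, p.1⟫_ℂ := by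
  have h1 : x ∈ kerSub A† z ↔ (x, z • x) ∈ A†.graph := by
    rw [LinearPMap.mem_graph_iff]
    constructor
    · rintro ⟨hx, h⟩
      exact ⟨⟨x, hx⟩, rfl, h⟩
    · rintro ⟨y, hy, h⟩
      change (y : E) = x at hy
      subst hy
      exact ⟨y.2, h⟩
  rw [h1, LinearPMap.adjoint_graph_eq_graph_adjoint hd, Submodule.mem_adjoint_iff]
  have h2 : ∀ a b : E, ⟪b, x⟫_ℂ - ⟪a, z • x⟫_ℂ = 0 ↔ ⟪x, b⟫_ℂ = ⟪z • x, a⟫_ℂ := fun a b => by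
    rw [sub_eq_zero, ← inner_conj_symm b, ← inner_conj_symm a]
    exact (star_injective).eq_iff
  simp only [h2]
  constructor
  · intro h p hp
    have hc : IsClosed {p : E × E | ⟪x, p.2⟫_ℂ = ⟪z • x, p.1⟫_ℂ} :=
      isClosed_eq (by fun_prop) (by fun_prop)
    exact hc.closure_subset_iff.2 (fun q hq => h q.1 q.2 hq) hp
  · exact fun h a b hab => h (a, b) (Submodule.le_topologicalClosure _ hab)

end Abstract

/-! ### The momentum operators on a compact interval -/

/-- The operator `-i d/dE` on `L²(I, dE)` with periodic boundary condition; it is a self-adjoint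
extension of `dirichletMomentum I`. -/
noncomputable def intervalPeriodicMomentum (I : Set ℝ) : IntervalL2 I →ₗ.[ℂ] IntervalL2 I :=
  momentum (volume.restrict I) (sInf I) (sSup I)
    (LinearMap.eqLocus (LinearMap.fst ℂ ℂ ℂ) (LinearMap.snd ℂ ℂ ℂ))

theorem mem_neg_dirichletMomentum_graph {m M : ℝ} (hmM : m ≤ M)
    {p : IntervalL2 (Icc m M) × IntervalL2 (Icc m M)} :
    p ∈ (-dirichletMomentum (Icc m M)).graph ↔ ∃ f : ℝ → ℂ,
      AbsolutelyContinuousOnInterval f m M ∧ (f m = 0 ∧ f M = 0) ∧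
      p.1 =ᵐ[volume.restrict (Icc m M)] f ∧
      ∀ᵐ x, x ∈ Icc m M → HasDerivAt f (-Complex.I * p.2 x) x := by
  rw [mem_graph_neg, mem_dirichletMomentum_graph hmM]
  refine exists_congr fun f => and_congr_right fun _ => and_congr_right fun _ =>
    and_congr_right fun _ => ?_
  rw [← ae_restrict_iff' measurableSet_Icc]
  refine eventually_congr ?_
  filter_upwards [Lp.coeFn_neg p.2] with x hx
  rw [hx, Pi.neg_apply, mul_neg, neg_mul]

theorem mem_neg_intervalPeriodicMomentum_graph {m M : ℝ} (hmM : m ≤ M)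
    {p : IntervalL2 (Icc m M) × IntervalL2 (Icc m M)} :
    p ∈ (-intervalPeriodicMomentum (Icc m M)).graph ↔ ∃ f : ℝ → ℂ,
      AbsolutelyContinuousOnInterval f m M ∧ f m = f M ∧
      p.1 =ᵐ[volume.restrict (Icc m M)] f ∧
      ∀ᵐ x, x ∈ Icc m M → HasDerivAt f (-Complex.I * p.2 x) x := by
  rw [mem_graph_neg, intervalPeriodicMomentum, csInf_Icc hmM, csSup_Icc hmM,
    momentum_graph_eq _ _ _ _ hmM Measure.AbsolutelyContinuous.rfl
      Measure.AbsolutelyContinuous.rfl]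
  refine exists_congr fun f => and_congr_right fun _ => and_congr_right fun _ =>
    and_congr_right fun _ => ?_
  rw [← ae_restrict_iff' measurableSet_Icc]
  refine eventually_congr ?_
  filter_upwards [Lp.coeFn_neg p.2] with x hx
  rw [hx, Pi.neg_apply, mul_neg, neg_mul]

theorem dirichletMomentum_le_intervalPeriodicMomentum {m M : ℝ} (hmM : m ≤ M) :
    (-dirichletMomentum (Icc m M)).graph ≤ (-intervalPeriodicMomentum (Icc m M)).graph := by
  intro p hp
  obtain ⟨f, h1, h2, h3⟩ := (mem_neg_dirichletMomentum_graph hmM).1 hp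
  exact (mem_neg_intervalPeriodicMomentum_graph hmM).2 ⟨f, h1, h2.1.trans h2.2.symm, h3⟩

theorem integral_restrict_Icc {m M : ℝ} (hmM : m ≤ M) (f : ℝ → ℂ) :
    ∫ x, f x ∂volume.restrict (Icc m M) = ∫ x in m..M, f x := by
  rw [intervalIntegral.integral_of_le hmM, integral_Icc_eq_integral_Ioc]

/-- Given `w` and a value `y`, there is an absolutely continuous `f` with `f m = e^{-cm} y`
such that `h := w - i c f` satisfies `i f' = h`. -/
theorem exists_resolvent_solution {m M : ℝ} (hmM : m ≤ M) (c : ℝ) (y : ℂ)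
    (w : IntervalL2 (Icc m M)) :
    ∃ (f : ℝ → ℂ) (p : IntervalL2 (Icc m M) × IntervalL2 (Icc m M)),
      AbsolutelyContinuousOnInterval f m M ∧ Complex.exp (c * m) * f m = y ∧
      Complex.exp (c * M) * f M = y + ∫ s in m..M, Complex.exp (c * s) * (-Complex.I * w s) ∧
      p.1 =ᵐ[volume.restrict (Icc m M)] f ∧
      (∀ᵐ x, x ∈ Icc m M → HasDerivAt f (-Complex.I * p.2 x) x) ∧
      p.2 + (c * Complex.I) • p.1 = w := by
  obtain ⟨f, hf, h1, h2, h3⟩ := exists_ode_solution hmM c y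
    ((intervalIntegrable_of_Lp hmM w).const_mul (-Complex.I))
  have hfL := hf.memLp hmM
  refine ⟨f, (hfL.toLp f, w - (c * Complex.I) • hfL.toLp f), hf, h1, h2, hfL.coeFn_toLp, ?_,
    sub_add_cancel _ _⟩
  rw [← ae_restrict_iff' measurableSet_Icc] at h3 ⊢
  filter_upwards [h3, hfL.coeFn_toLp, Lp.coeFn_sub w ((c * Complex.I) • hfL.toLp f),
    Lp.coeFn_smul (c * Complex.I : ℂ) (hfL.toLp f)] with x h4 h5 h6 h7
  refine h4.congr_deriv ?_
  rw [h6, Pi.sub_apply, h7, Pi.smul_apply, h5, smul_eq_mul]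
  linear_combination (-c * f x) * Complex.I_mul_I

open scoped ComplexConjugate in
/-- Integration by parts: the boundary form of `-P`. -/
theorem inner_sub_inner_eq_of_hasDerivAt {m M : ℝ} (hmM : m ≤ M)
    {p q : IntervalL2 (Icc m M) × IntervalL2 (Icc m M)} {f h : ℝ → ℂ}
    (hf : AbsolutelyContinuousOnInterval f m M) (hh : AbsolutelyContinuousOnInterval h m M)
    (hpf : p.1 =ᵐ[volume.restrict (Icc m M)] f) (hqh : q.1 =ᵐ[volume.restrict (Icc m M)] h)
    (hf' : ∀ᵐ x, x ∈ Icc m M → HasDerivAt f (-Complex.I * p.2 x) x)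
    (hh' : ∀ᵐ x, x ∈ Icc m M → HasDerivAt h (-Complex.I * q.2 x) x) :
    conj (f M) * h M = conj (f m) * h m + Complex.I * (⟪p.2, q.1⟫_ℂ - ⟪p.1, q.2⟫_ℂ) := by
  have hac : AbsolutelyContinuousOnInterval (fun x => conj (f x) * h x) m M := by
    simpa using! (AbsolutelyContinuousOnInterval.isometry_comp Complex.isometry_conj hf).smul hh
  have i1 := L2.integrable_inner (𝕜 := ℂ) p.2 q.1
  have i2 := L2.integrable_inner (𝕜 := ℂ) p.1 q.2
  have hi : IntervalIntegrable
      (fun x => Complex.I * (⟪p.2 x, q.1 x⟫_ℂ - ⟪p.1 x, q.2 x⟫_ℂ)) volume m M := by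
    rw [intervalIntegrable_iff_integrableOn_Icc_of_le hmM]
    exact (i1.sub i2).const_mul _
  rw [hac.eq_add_intervalIntegral hmM hi ?_ (right_mem_Icc.2 hmM), L2.inner_def, L2.inner_def,
    ← integral_sub i1 i2, ← integral_const_mul, integral_restrict_Icc hmM]
  rw [← ae_restrict_iff' measurableSet_Icc] at hf' hh' ⊢
  filter_upwards [hf', hh', hpf, hqh] with x h1 h2 h3 h4
  have h1' : HasDerivAt (fun x => conj (f x)) (conj (-Complex.I * p.2 x)) x :=
    Complex.conjCLE.toContinuousLinearMap.hasFDerivAt.comp_hasDerivAt x h1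
  refine (h1'.mul h2).congr_deriv ?_
  rw [h3, h4, RCLike.inner_apply, RCLike.inner_apply, map_mul, map_neg, Complex.conj_I]
  ring

theorem intervalPeriodicMomentum_basicCriterion {m M : ℝ} (hmM : m < M) :
    SatisfiesBasicCriterion (-intervalPeriodicMomentum (Icc m M)) := by
  have hsurj : ∀ c : ℝ, c ≠ 0 → ∀ w, ∃ p ∈ (-intervalPeriodicMomentum (Icc m M)).graph,
      p.2 + (c * Complex.I) • p.1 = w := by
    intro c hc w
    set W := ∫ s in m..M, Complex.exp (c * s) * (-Complex.I * w s) with hW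
    have hne : Complex.exp (c * M) - Complex.exp (c * m) ≠ 0 := by
      rw [sub_ne_zero]
      intro h
      norm_cast at h
      rw [Real.exp_eq_exp] at h
      exact hmM.ne' (mul_left_cancel₀ hc h)
    -- The initial value is chosen so that both boundary values of `f` equal
    -- `W / (e^{cM} - e^{cm})`.
    obtain ⟨f, p, hf, h1, h2, h3, h4, h5⟩ := exists_resolvent_solution hmM.le c
      (Complex.exp (c * m) * (W / (Complex.exp (c * M) - Complex.exp (c * m)))) w
    refine ⟨p, (mem_neg_intervalPeriodicMomentum_graph hmM.le).2 ⟨f, hf, ?_, h3, h4⟩, h5⟩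
    have h6 := mul_left_cancel₀ (Complex.exp_ne_zero _) h1
    refine mul_left_cancel₀ (Complex.exp_ne_zero (c * M)) ?_
    rw [h2, h6, ← hW]
    field_simp
    ring
  refine ⟨fun p hp q hq => ?_, fun w => ?_, fun w => ?_⟩
  · obtain ⟨f, hf, hfb, hf1, hf2⟩ := (mem_neg_intervalPeriodicMomentum_graph hmM.le).1 hp
    obtain ⟨h, hh, hhb, hh1, hh2⟩ := (mem_neg_intervalPeriodicMomentum_graph hmM.le).1 hq
    have key := inner_sub_inner_eq_of_hasDerivAt hmM.le hf hh hf1 hh1 hf2 hh2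
    rw [hfb, hhb, left_eq_add, mul_eq_zero, sub_eq_zero] at key
    exact key.resolve_left Complex.I_ne_zero
  · simpa using hsurj 1 one_ne_zero w
  · simpa [sub_eq_add_neg] using hsurj (-1) (by norm_num) w

/-- The function `e^{cE}` as an element of `L²([m, M], dE)`. -/
noncomputable def expLp (m M c : ℝ) : IntervalL2 (Icc m M) :=
  (memLp_of_continuousOn (f := fun x : ℝ => Complex.exp (c * x))
    (contDiff_cexp_mul c).continuous.continuousOn).toLp _

theorem coeFn_expLp (m M c : ℝ) :
    expLp m M c =ᵐ[volume.restrict (Icc m M)] fun x : ℝ => Complex.exp (c * x) :=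
  MemLp.coeFn_toLp _

theorem expLp_ne_zero {m M : ℝ} (hmM : m < M) (c : ℝ) : expLp m M c ≠ 0 := by
  intro h
  have h1 := coeFn_expLp m M c
  rw [h] at h1
  have h2 : ∀ᵐ _ ∂volume.restrict (Icc m M), False := by
    filter_upwards [h1, Lp.coeFn_zero ℂ 2 (volume.restrict (Icc m M))] with x h3 h4
    rw [h4] at h3
    exact Complex.exp_ne_zero _ h3.symm
  rw [ae_restrict_iff' measurableSet_Icc] at h2
  have h3 : volume (Icc m M) = 0 := by
    rw [measure_eq_zero_iff_ae_notMem]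
    exact h2
  rw [Real.volume_Icc, ENNReal.ofReal_eq_zero] at h3
  linarith

theorem inner_expLp {m M : ℝ} (hmM : m ≤ M) (c : ℝ) (w : IntervalL2 (Icc m M)) :
    ⟪expLp m M c, w⟫_ℂ = ∫ s in m..M, Complex.exp (c * s) * w s := by
  rw [L2.inner_def, ← integral_restrict_Icc hmM]
  refine integral_congr_ae ?_
  filter_upwards [coeFn_expLp m M c] with x hx
  rw [hx, RCLike.inner_apply, ← Complex.exp_conj, map_mul, Complex.conj_ofReal,
    Complex.conj_ofReal, mul_comm]

/-- The deficiency subspaces of `-P` on `[m, M]` are spanned by exponentials: the range of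
`-P + i c` is the orthogonal complement of `e^{cE}`. -/
theorem mem_span_expLp_iff {m M : ℝ} (hmM : m ≤ M) (c : ℝ) (x : IntervalL2 (Icc m M)) :
    x ∈ Submodule.span ℂ {expLp m M c} ↔
      ∀ p ∈ (-dirichletMomentum (Icc m M)).graph, ⟪x, p.2⟫_ℂ = ⟪(c * Complex.I) • x, p.1⟫_ℂ := by
  have hz : ∀ p : IntervalL2 (Icc m M) × IntervalL2 (Icc m M),
      ⟪x, p.2⟫_ℂ = ⟪(c * Complex.I) • x, p.1⟫_ℂ ↔ ⟪x, p.2 + (c * Complex.I) • p.1⟫_ℂ = 0 := by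
    intro p
    rw [inner_add_right, inner_smul_right, inner_smul_left, map_mul, Complex.conj_ofReal,
      Complex.conj_I, add_eq_zero_iff_eq_neg]
    simp
  have hI : ∀ w : IntervalL2 (Icc m M),
      ∫ s in m..M, Complex.exp (c * s) * (-Complex.I * w s) =
        -Complex.I * ⟪expLp m M c, w⟫_ℂ := by
    intro w
    rw [inner_expLp hmM, ← intervalIntegral.integral_const_mul]
    exact intervalIntegral.integral_congr fun s _ => by ring
  constructor
  · intro hx p hp
    obtain ⟨a, rfl⟩ := Submodule.mem_span_singleton.1 hx
    rw [hz, inner_smul_left]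
    obtain ⟨f, hf, hfb, hf1, hf2⟩ := (mem_neg_dirichletMomentum_graph hmM).1 hp
    set w := p.2 + (c * Complex.I) • p.1 with hw
    have h1 := integral_exp_mul_eq hmM (c := c) (w := fun s => -Complex.I * w s) hf
      ((intervalIntegrable_of_Lp hmM w).const_mul _) (by
        rw [← ae_restrict_iff' measurableSet_Icc] at hf2 ⊢
        filter_upwards [hf2, hf1, Lp.coeFn_add p.2 ((c * Complex.I) • p.1),
          Lp.coeFn_smul (c * Complex.I : ℂ) p.1] with x h1 h2 h3 h4
        refine h1.congr_deriv ?_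
        rw [hw, h3, Pi.add_apply, h4, Pi.smul_apply, h2, smul_eq_mul]
        linear_combination (c * f x) * Complex.I_mul_I) (right_mem_Icc.2 hmM)
    rw [hI, hfb.1, hfb.2, mul_zero, mul_zero, zero_add, eq_comm, mul_eq_zero] at h1
    rw [h1.resolve_left (neg_ne_zero.2 Complex.I_ne_zero), mul_zero]
  · intro h
    rw [← Submodule.orthogonal_orthogonal (Submodule.span ℂ {expLp m M c}),
      Submodule.mem_orthogonal']
    intro w hw
    rw [Submodule.mem_orthogonal_singleton_iff_inner_right] at hw
    obtain ⟨f, p, hf, h1, h2, h3, h4, rfl⟩ := exists_resolvent_solution hmM c 0 w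
    rw [hI, hw, mul_zero, add_zero] at h2
    refine (hz p).1 (h p ((mem_neg_dirichletMomentum_graph hmM).2 ⟨f, hf, ⟨?_, ?_⟩, h3, h4⟩))
    · exact (mul_eq_zero.1 h1).resolve_left (Complex.exp_ne_zero _)
    · exact (mul_eq_zero.1 h2).resolve_left (Complex.exp_ne_zero _)

/-! ### A core for the Dirichlet momentum operator -/

/-- The pairs `(φ, i φ')` with `φ` continuously differentiable and vanishing outside a compact
subinterval of `(m, M)`, as elements of `L²(K) × L²(K)`; the case of interest is
`K = [m, M]`. -/
def testGraph (K : Set ℝ) (m M : ℝ) : Set (IntervalL2 K × IntervalL2 K) :=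
  {p | ∃ (φ : ℝ → ℂ) (m' M' : ℝ), m < m' ∧ M' < M ∧ ContDiff ℝ 1 φ ∧
    (∀ x ∉ Icc m' M', φ x = 0) ∧ p.1 =ᵐ[volume.restrict K] φ ∧
    p.2 =ᵐ[volume.restrict K] fun x => Complex.I * deriv φ x}

/-- The continuously differentiable functions vanishing outside a compact subinterval of
`(m, M)`, as a subspace of `L²([m, M])`. -/
def compactlySupported (m M : ℝ) : Submodule ℂ (IntervalL2 (Icc m M)) where
  carrier := {w | ∃ (φ : ℝ → ℂ) (m' M' : ℝ), m < m' ∧ M' < M ∧ ContDiff ℝ 1 φ ∧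
    (∀ x ∉ Icc m' M', φ x = 0) ∧ w =ᵐ[volume.restrict (Icc m M)] φ}
  zero_mem' := ⟨fun _ => 0, m + 1, M - 1, by linarith, by linarith, contDiff_const,
    fun _ _ => rfl, Lp.coeFn_zero ℂ 2 _⟩
  add_mem' := by
    rintro v w ⟨φ, m₁, M₁, hm₁, hM₁, hφ, hφ0, hv⟩ ⟨ψ, m₂, M₂, hm₂, hM₂, hψ, hψ0, hw⟩
    refine ⟨φ + ψ, min m₁ m₂, max M₁ M₂, lt_min hm₁ hm₂, max_lt hM₁ hM₂, hφ.add hψ,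
      fun x hx => ?_, (Lp.coeFn_add _ _).trans (hv.add hw)⟩
    rw [Pi.add_apply, hφ0 x (fun h => hx ⟨min_le_of_left_le h.1, le_max_of_le_left h.2⟩),
      hψ0 x (fun h => hx ⟨min_le_of_right_le h.1, le_max_of_le_right h.2⟩), add_zero]
  smul_mem' := by
    rintro c v ⟨φ, m₁, M₁, hm₁, hM₁, hφ, hφ0, hv⟩
    exact ⟨c • φ, m₁, M₁, hm₁, hM₁, contDiff_const.smul hφ, fun x hx => by simp [hφ0 x hx],
      (Lp.coeFn_smul _ _).trans (hv.const_smul c)⟩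

theorem exists_Icc_of_tsupport_subset_Ioo {m M : ℝ} {φ : ℝ → ℝ}
    (hφ : HasCompactSupport φ) (hs : tsupport φ ⊆ Ioo m M) :
    ∃ m' M', m < m' ∧ M' < M ∧ ∀ x ∉ Icc m' M', φ x = 0 := by
  rcases (tsupport φ).eq_empty_or_nonempty with h | h
  · exact ⟨m + 1, M - 1, by linarith, by linarith, fun x _ =>
      image_eq_zero_of_notMem_tsupport (by rw [h]; exact notMem_empty x)⟩
  · obtain ⟨m', hm', hl⟩ := hφ.isCompact.exists_isLeast h
    obtain ⟨M', hM', hg⟩ := hφ.isCompact.exists_isGreatest h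
    exact ⟨m', M', (hs hm').1, (hs hM').2, fun x hx =>
      image_eq_zero_of_notMem_tsupport fun hxs => hx ⟨hl hxs, hg hxs⟩⟩

theorem dense_compactlySupported (m M : ℝ) :
    Dense (compactlySupported m M : Set (IntervalL2 (Icc m M))) := by
  rw [Submodule.dense_iff_topologicalClosure_eq_top, Submodule.topologicalClosure_eq_top_iff,
    Submodule.eq_bot_iff]
  intro x hx
  have hloc : LocallyIntegrableOn x (Ioo m M) (volume.restrict (Icc m M)) :=
    (((Lp.memLp x).integrable (by norm_num)).locallyIntegrable).locallyIntegrableOn _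
  have h0 := isOpen_Ioo.ae_eq_zero_of_integral_contDiff_smul_eq_zero hloc (fun g hg hgc hgs => by
    have hg0 : MemLp (fun x => (g x : ℂ)) 2 (volume.restrict (Icc m M)) :=
      memLp_of_continuousOn (Complex.continuous_ofReal.comp hg.continuous).continuousOn
    obtain ⟨m', M', hm', hM', hz⟩ := exists_Icc_of_tsupport_subset_Ioo hgc hgs
    have h1 := (Submodule.mem_orthogonal _ _).1 hx (hg0.toLp _) ⟨fun x => (g x : ℂ), m', M', hm',
      hM', Complex.ofRealCLM.contDiff.comp (hg.of_le (by exact_mod_cast le_top)),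
      fun x hx => by simp [hz x hx],
      hg0.coeFn_toLp⟩
    rw [L2.inner_def] at h1
    rw [← h1]
    refine integral_congr_ae ?_
    filter_upwards [hg0.coeFn_toLp] with t ht
    rw [ht, RCLike.inner_apply, Complex.conj_ofReal, Complex.real_smul, mul_comm])
  apply Lp.ext
  have hmem : ∀ᵐ t ∂volume.restrict (Icc m M), t ∈ Ioo m M := by
    rw [← Measure.restrict_congr_set Ioo_ae_eq_Icc]
    exact ae_restrict_mem measurableSet_Ioo
  filter_upwards [h0, hmem, Lp.coeFn_zero ℂ 2 (volume.restrict (Icc m M))] with t h1 h2 h3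
  rw [h1 h2, h3]
  rfl

theorem norm_intervalIntegral_Lp_le {m M : ℝ} (w : IntervalL2 (Icc m M)) {x : ℝ}
    (hx : x ∈ Icc m M) : ‖∫ t in m..x, w t‖ ≤ (M - m) ^ (1 / 2 : ℝ) * ‖w‖ := by
  have hmM := hx.1.trans hx.2
  have hs : volume.restrict (Icc m M) (Ioc m x) ≠ ⊤ := measure_ne_top _ _
  have h1 : ∫ t in m..x, w t = ⟪indicatorConstLp 2 measurableSet_Ioc hs (1 : ℂ), w⟫_ℂ := by
    rw [L2.inner_indicatorConstLp_one, intervalIntegral.integral_of_le hx.1,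
      Measure.restrict_restrict measurableSet_Ioc, inter_eq_left.2]
    exact fun t ht => ⟨ht.1.le, ht.2.trans hx.2⟩
  rw [h1]
  refine (norm_inner_le_norm _ _).trans (mul_le_mul_of_nonneg_right ?_ (norm_nonneg _))
  refine norm_indicatorConstLp_le.trans ?_
  rw [norm_one, one_mul, ENNReal.toReal_ofNat]
  refine Real.rpow_le_rpow measureReal_nonneg ?_ (by norm_num)
  refine (measureReal_mono (subset_univ _)).trans ?_
  rw [measureReal_restrict_apply_univ, Real.volume_real_Icc_of_le hmM]

theorem continuousOn_intervalIntegral_Lp {m M : ℝ} (hmM : m ≤ M) (w : IntervalL2 (Icc m M)) :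
    ContinuousOn (fun x => ∫ t in m..x, w t) (Icc m M) := by
  have := (absolutelyContinuousOnInterval_intervalIntegral (intervalIntegrable_of_Lp hmM w)
    left_mem_uIcc).continuousOn
  rwa [uIcc_of_le hmM] at this

/-- The Volterra operator `(N w)(x) = ∫_m^x w` on `L²([m, M])`. -/
noncomputable def volterra {m M : ℝ} (hmM : m ≤ M) :
    IntervalL2 (Icc m M) →L[ℂ] IntervalL2 (Icc m M) :=
  LinearMap.mkContinuous
    { toFun := fun w => (memLp_of_continuousOn (continuousOn_intervalIntegral_Lp hmM w)).toLp _
      map_add' := fun v w => by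
        rw [← MemLp.toLp_add]
        refine MemLp.toLp_congr _ _ ?_
        filter_upwards [ae_restrict_mem measurableSet_Icc] with x hx
        have hsub : uIcc m x ⊆ uIcc m M := by
          rw [uIcc_of_le hx.1, uIcc_of_le hmM]; exact Icc_subset_Icc_right hx.2
        rw [Pi.add_apply, ← intervalIntegral.integral_add
          ((intervalIntegrable_of_Lp hmM v).mono_set hsub)
          ((intervalIntegrable_of_Lp hmM w).mono_set hsub)]
        refine intervalIntegral.integral_congr_ae ?_
        filter_upwards [(ae_restrict_iff' measurableSet_Icc).1 (Lp.coeFn_add v w)] with t h1 h2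
        rw [uIoc_of_le hx.1] at h2
        rw [h1 ⟨h2.1.le, h2.2.trans hx.2⟩, Pi.add_apply]
      map_smul' := fun c w => by
        rw [RingHom.id_apply, ← MemLp.toLp_const_smul]
        refine MemLp.toLp_congr _ _ ?_
        filter_upwards [ae_restrict_mem measurableSet_Icc] with x hx
        rw [Pi.smul_apply, ← intervalIntegral.integral_smul]
        refine intervalIntegral.integral_congr_ae ?_
        filter_upwards [(ae_restrict_iff' measurableSet_Icc).1 (Lp.coeFn_smul c w)] with t h1 h2
        rw [uIoc_of_le hx.1] at h2
        rw [h1 ⟨h2.1.le, h2.2.trans hx.2⟩, Pi.smul_apply] }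
    ((volume.restrict (Icc m M)).real univ ^ (1 / 2 : ℝ) * (M - m) ^ (1 / 2 : ℝ))
    (fun w => by
      have hM : 0 ≤ M - m := sub_nonneg.2 hmM
      have h := Lp.norm_le_of_ae_bound (p := 2)
        (f := (memLp_of_continuousOn (continuousOn_intervalIntegral_Lp hmM w)).toLp _)
        (C := (M - m) ^ (1 / 2 : ℝ) * ‖w‖) (by positivity) (by
          filter_upwards [MemLp.coeFn_toLp
            (memLp_of_continuousOn (continuousOn_intervalIntegral_Lp hmM w)),
            ae_restrict_mem measurableSet_Icc] with x h1 h2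
          rw [h1]
          exact norm_intervalIntegral_Lp_le w h2)
      refine h.trans (le_of_eq ?_)
      rw [mul_assoc]
      rw [ENNReal.toReal_ofNat, one_div]
      rfl)

theorem coeFn_volterra {m M : ℝ} (hmM : m ≤ M) (w : IntervalL2 (Icc m M)) :
    volterra hmM w =ᵐ[volume.restrict (Icc m M)] fun x => ∫ t in m..x, w t :=
  MemLp.coeFn_toLp (memLp_of_continuousOn (continuousOn_intervalIntegral_Lp hmM w))

theorem eq_volterra_of_mem_graph {m M : ℝ} (hmM : m ≤ M)
    {p : IntervalL2 (Icc m M) × IntervalL2 (Icc m M)}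
    (hp : p ∈ (-dirichletMomentum (Icc m M)).graph) :
    p.1 = volterra hmM (-Complex.I • p.2) ∧ ⟪expLp m M 0, p.2⟫_ℂ = 0 := by
  obtain ⟨f, hf, hfb, hf1, hf2⟩ := (mem_neg_dirichletMomentum_graph hmM).1 hp
  have hi := (intervalIntegrable_of_Lp hmM p.2).const_mul (-Complex.I)
  have key := fun {x} (hx : x ∈ Icc m M) => hf.eq_add_intervalIntegral hmM hi hf2 hx
  constructor
  · apply Lp.ext
    filter_upwards [hf1, coeFn_volterra hmM (-Complex.I • p.2),
      ae_restrict_mem measurableSet_Icc] with x h1 h2 hx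
    rw [h1, h2, key hx, hfb.1, zero_add]
    refine intervalIntegral.integral_congr_ae ?_
    filter_upwards [(ae_restrict_iff' measurableSet_Icc).1 (Lp.coeFn_smul (-Complex.I) p.2)]
      with t h1 h2
    rw [uIoc_of_le hx.1] at h2
    rw [h1 ⟨h2.1.le, h2.2.trans hx.2⟩, Pi.smul_apply, smul_eq_mul]
  · have h1 := key (right_mem_Icc.2 hmM)
    rw [hfb.1, hfb.2, zero_add, intervalIntegral.integral_const_mul, eq_comm, mul_eq_zero] at h1
    rw [inner_expLp hmM]
    simpa using h1.resolve_left (neg_ne_zero.2 Complex.I_ne_zero)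

theorem volterra_mem_testGraph {m M : ℝ} (hmM : m ≤ M) {w : IntervalL2 (Icc m M)}
    (hw : w ∈ compactlySupported m M) (hw0 : ⟪expLp m M 0, w⟫_ℂ = 0) :
    (volterra hmM (-Complex.I • w), w) ∈ testGraph (Icc m M) m M := by
  obtain ⟨φ, m', M', hm', hM', hφ, hφ0, hwφ⟩ := hw
  replace hφ := hφ.continuous
  have hw' := (ae_restrict_iff' measurableSet_Icc).1 hwφ
  have hd : ∀ x, HasDerivAt (fun x => ∫ t in m..x, -Complex.I * φ t) (-Complex.I * φ x) x :=
    fun x => (continuous_const.mul hφ).integral_hasStrictDerivAt m x |>.hasDerivAt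
  have hderiv : deriv (fun x => ∫ t in m..x, -Complex.I * φ t) = fun x => -Complex.I * φ x :=
    funext fun x => (hd x).deriv
  refine ⟨fun x => ∫ t in m..x, -Complex.I * φ t, m', M', hm', hM', ?_, ?_, ?_, ?_⟩
  · rw [contDiff_one_iff_deriv, hderiv]
    exact ⟨fun x => (hd x).differentiableAt, continuous_const.mul hφ⟩
  · have hz : ∀ x y, (∀ t ∈ uIoc x y, t ∉ Icc m' M') → ∫ t in x..y, -Complex.I * φ t = 0 := by
      intro x y h
      refine intervalIntegral.integral_zero_ae (ae_of_all _ fun t ht => ?_)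
      rw [hφ0 t (h t ht), mul_zero]
    intro x hx
    rcases lt_or_ge x m' with h | h
    · exact hz _ _ fun t ht h' => absurd (ht.2.trans_lt (max_lt hm' h)) (not_lt.2 h'.1)
    · have h2 : M' < x := not_le.1 fun h' => hx ⟨h, h'⟩
      have hint : ∀ x y, IntervalIntegrable (fun t => -Complex.I * φ t) volume x y :=
        fun x y => (continuous_const.mul hφ).intervalIntegrable x y
      have hmid : ∫ t in m..M, -Complex.I * φ t = 0 := by
        rw [inner_expLp hmM] at hw0
        rw [intervalIntegral.integral_const_mul, ← integral_restrict_Icc hmM,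
          ← integral_congr_ae hwφ, integral_restrict_Icc hmM]
        simpa using hw0
      show ∫ t in m..x, -Complex.I * φ t = 0
      rw [← intervalIntegral.integral_add_adjacent_intervals (hint m M) (hint M x), hmid, zero_add]
      exact hz _ _ fun t ht h' => absurd ((lt_min hM' h2).trans ht.1) (not_lt.2 h'.2)
  · filter_upwards [coeFn_volterra hmM (-Complex.I • w), ae_restrict_mem measurableSet_Icc]
      with x h1 hx
    rw [h1]
    refine intervalIntegral.integral_congr_ae ?_
    filter_upwards [(ae_restrict_iff' measurableSet_Icc).1 (Lp.coeFn_smul (-Complex.I) w), hw']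
      with t h1 h3 h2
    rw [uIoc_of_le hx.1] at h2
    have h4 : t ∈ Icc m M := ⟨h2.1.le, h2.2.trans hx.2⟩
    rw [h1 h4, Pi.smul_apply, smul_eq_mul, h3 h4]
  · rw [hderiv]
    filter_upwards [hwφ] with x hx
    rw [hx]
    linear_combination φ x * Complex.I_mul_I

/-- The test functions are a core for `-P`: a mean-zero `w` is an `L²` limit of mean-zero
compactly supported functions, and the Volterra operator is continuous. -/
theorem graph_subset_closure_testGraph {m M : ℝ} (hmM : m < M)
    {p : IntervalL2 (Icc m M) × IntervalL2 (Icc m M)}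
    (hp : p ∈ (-dirichletMomentum (Icc m M)).graph) : p ∈ closure (testGraph (Icc m M) m M) := by
  obtain ⟨h1, h2⟩ := eq_volterra_of_mem_graph hmM.le hp
  obtain ⟨ρ, hρ, hρ1⟩ : ∃ ρ ∈ compactlySupported m M, ⟪expLp m M 0, ρ⟫_ℂ ≠ 0 := by
    by_contra! h
    have h3 : expLp m M 0 ∈ (compactlySupported m M)ᗮ := (Submodule.mem_orthogonal' _ _).2 h
    rw [Submodule.topologicalClosure_eq_top_iff.1
      (Submodule.dense_iff_topologicalClosure_eq_top.1 (dense_compactlySupported m M)),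
      Submodule.mem_bot] at h3
    exact expLp_ne_zero hmM 0 h3
  let Φ : IntervalL2 (Icc m M) → IntervalL2 (Icc m M) × IntervalL2 (Icc m M) := fun w =>
    (volterra hmM.le (-Complex.I • (w - (⟪expLp m M 0, w⟫_ℂ / ⟪expLp m M 0, ρ⟫_ℂ) • ρ)),
      w - (⟪expLp m M 0, w⟫_ℂ / ⟪expLp m M 0, ρ⟫_ℂ) • ρ)
  have hΦ : Continuous Φ := by fun_prop
  have hΦp : Φ p.2 = p := by
    simp only [Φ, h2, zero_div, zero_smul, sub_zero, ← h1]
  rw [← hΦp]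
  refine map_mem_closure hΦ (dense_compactlySupported m M p.2) fun w hw => ?_
  refine volterra_mem_testGraph hmM.le
    (Submodule.sub_mem _ hw (Submodule.smul_mem _ _ hρ)) ?_
  rw [inner_sub_right, inner_smul_right, div_mul_cancel₀ _ hρ1, sub_self]

theorem testGraph_subset_graph {m M : ℝ} (hmM : m ≤ M)
    {p : IntervalL2 (Icc m M) × IntervalL2 (Icc m M)} (hp : p ∈ testGraph (Icc m M) m M) :
    p ∈ (-dirichletMomentum (Icc m M)).graph := by
  obtain ⟨φ, m', M', hm', hM', hφ, hφ0, h1, h2⟩ := hp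
  refine (mem_neg_dirichletMomentum_graph hmM).2 ⟨φ,
    absolutelyContinuousOnInterval_of_contDiff hφ m M,
    ⟨hφ0 m fun h => hm'.not_ge h.1, hφ0 M fun h => hM'.not_ge h.2⟩, h1, ?_⟩
  rw [← ae_restrict_iff' measurableSet_Icc]
  filter_upwards [h2] with x hx
  refine ((hφ.differentiable one_ne_zero).differentiableAt.hasDerivAt).congr_deriv ?_
  rw [hx]
  linear_combination (deriv φ x) * Complex.I_mul_I

theorem dense_dirichletMomentum_domain {m M : ℝ} (hmM : m ≤ M) :
    Dense ((-dirichletMomentum (Icc m M)).domain : Set (IntervalL2 (Icc m M))) := by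
  refine (dense_compactlySupported m M).mono ?_
  rintro w ⟨φ, m', M', hm', hM', hφ, hφ0, hw⟩
  have hd := memLp_of_continuousOn (m := m) (M := M)
    ((continuous_const (y := Complex.I)).mul (hφ.continuous_deriv le_rfl)).continuousOn
  exact LinearPMap.mem_domain_of_mem_graph (testGraph_subset_graph hmM (p := (w, hd.toLp _))
    ⟨φ, m', M', hm', hM', hφ, hφ0, hw, hd.coeFn_toLp⟩)

/-! ### Change of variables along a monotone branch -/

/-- `J ⊆ [0, 2π]` is a measurable set on which `g` is injective with nonvanishing derivative, and
`K` is the image `g(J)` up to a null set. -/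
structure IsBranch (g : ℝ → ℝ) (J K : Set ℝ) : Prop where
  differentiable : Differentiable ℝ g
  continuous_deriv : Continuous (deriv g)
  measurableSet : MeasurableSet J
  subset : J ⊆ Icc 0 (2 * Real.pi)
  injOn : InjOn g J
  deriv_ne_zero : ∀ k ∈ J, deriv g k ≠ 0
  image_ae_eq : g '' J =ᵐ[volume] K

theorem ae_circleMeasure_iff {p : ℝ → Prop} :
    (∀ᵐ k ∂circleMeasure, p k) ↔ ∀ᵐ k, k ∈ Icc 0 (2 * Real.pi) → p k := by
  rw [← ae_restrict_iff' measurableSet_Icc]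
  exact ⟨fun h => circleMeasure_ac.2.ae_le h, fun h => circleMeasure_ac.1.ae_le h⟩

theorem lintegral_circleMeasure (F : ℝ → ENNReal) :
    ∫⁻ k, F k ∂circleMeasure =
      ENNReal.ofReal (1 / (2 * Real.pi)) * ∫⁻ k in Icc 0 (2 * Real.pi), F k := by
  rw [circleMeasure, lintegral_smul_measure, smul_eq_mul]

namespace IsBranch

variable {g : ℝ → ℝ} {J K : Set ℝ}

theorem restrict_eq (h : IsBranch g J K) : volume.restrict (g '' J) = volume.restrict K :=
  Measure.restrict_congr_set h.image_ae_eq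

theorem lintegral_eq (h : IsBranch g J K) (F : ℝ → ENNReal) :
    ∫⁻ E in K, F E = ∫⁻ k in J, ENNReal.ofReal |deriv g k| * F (g k) := by
  rw [← h.restrict_eq, lintegral_image_eq_lintegral_abs_deriv_mul h.measurableSet
    (fun k _ => (h.differentiable k).hasDerivAt.hasDerivWithinAt) h.injOn]

theorem quasiMeasurePreserving (h : IsBranch g J K) :
    Measure.QuasiMeasurePreserving g (volume.restrict J) (volume.restrict K) := by
  refine ⟨h.differentiable.continuous.measurable, Measure.AbsolutelyContinuous.mk fun s hs h0 => ?_⟩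
  have hgs := h.differentiable.continuous.measurable hs
  rw [Measure.map_apply h.differentiable.continuous.measurable hs]
  have h1 := h.lintegral_eq (s.indicator 1)
  have hm : Measurable fun k => ENNReal.ofReal |deriv g k| * s.indicator 1 (g k) :=
    h.continuous_deriv.abs.measurable.ennreal_ofReal.mul
      ((measurable_one.indicator hs).comp h.differentiable.continuous.measurable)
  rw [lintegral_indicator_one hs, h0, eq_comm, lintegral_eq_zero_iff hm] at h1
  rw [measure_eq_zero_iff_ae_notMem]
  filter_upwards [h1, ae_restrict_mem h.measurableSet] with k h2 hk hks
  have h3 : s.indicator (1 : ℝ → ENNReal) (g k) = 1 :=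
    indicator_of_mem (s := s) hks _
  rw [h3, mul_one, Pi.zero_apply, ENNReal.ofReal_eq_zero, abs_nonpos_iff] at h2
  exact h.deriv_ne_zero k hk h2

theorem ae_of_ae_comp (h : IsBranch g J K) {p : ℝ → Prop}
    (hp : ∀ᵐ k ∂volume.restrict J, p (g k)) : ∀ᵐ E ∂volume.restrict K, p E := by
  rw [ae_restrict_iff' h.measurableSet, ae_iff] at hp
  rw [← h.restrict_eq, ae_restrict_iff' (h.measurableSet.image_of_continuousOn_injOn
    h.differentiable.continuous.continuousOn h.injOn), ae_iff]
  refine measure_mono_null ?_ (addHaar_image_eq_zero_of_differentiableOn_of_addHaar_eq_zero volume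
    h.differentiable.differentiableOn hp)
  intro E hE
  simp only [mem_ofPred_eq, Classical.not_imp] at hE
  obtain ⟨⟨k, hk, rfl⟩, hE⟩ := hE
  exact ⟨k, fun h => hE (h hk), rfl⟩

theorem sqrt_ne_zero (h : IsBranch g J K) {k : ℝ}
    (hk : k ∈ J) : (Real.sqrt (2 * Real.pi * |deriv g k|) : ℂ) ≠ 0 := by
  rw [Complex.ofReal_ne_zero]
  have := abs_pos.2 (h.deriv_ne_zero k hk)
  positivity

theorem ae_restrict_of_ae_circleMeasure (h : IsBranch g J K)
    {p : ℝ → Prop} (hp : ∀ᵐ k ∂circleMeasure, p k) : ∀ᵐ k ∂volume.restrict J, p k :=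
  (Measure.restrict_mono_set volume h.subset).absolutelyContinuous.ae_le
    (circleMeasure_ac.2.ae_le hp)

/-- The weighted composition `√(2π|g'|) u ∘ g`, cut off outside the branch `J`. -/
noncomputable def pullback (g : ℝ → ℝ) (J : Set ℝ) (u : ℝ → ℂ) : ℝ → ℂ :=
  J.indicator fun k => (Real.sqrt (2 * Real.pi * |deriv g k|) : ℂ) * u (g k)

theorem pullback_congr (h : IsBranch g J K) {u v : ℝ → ℂ} (huv : u =ᵐ[volume.restrict K] v) :
    pullback g J u =ᵐ[volume] pullback g J v := by
  have h1 := (ae_restrict_iff' h.measurableSet).1 (h.quasiMeasurePreserving.ae huv)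
  filter_upwards [h1] with k hk
  simp only [pullback, indicator]
  split_ifs with hkJ
  · rw [hk hkJ]
  · rfl

theorem eLpNorm_pullback (h : IsBranch g J K) (u : ℝ → ℂ) :
    eLpNorm (pullback g J u) 2 circleMeasure = eLpNorm u 2 (volume.restrict K) := by
  rw [eLpNorm_eq_lintegral_rpow_enorm_toReal (by norm_num) (by norm_num),
    eLpNorm_eq_lintegral_rpow_enorm_toReal (by norm_num) (by norm_num)]
  congr 1
  rw [h.lintegral_eq, lintegral_circleMeasure, ← lintegral_const_mul' _ _ ENNReal.ofReal_ne_top]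
  have h1 : ∀ k, ENNReal.ofReal (1 / (2 * Real.pi)) *
        ‖pullback g J u k‖ₑ ^ ENNReal.toReal 2 =
      J.indicator (fun k => ENNReal.ofReal |deriv g k| * ‖u (g k)‖ₑ ^ ENNReal.toReal 2) k := by
    intro k
    simp only [pullback, indicator]
    split_ifs with hk
    · rw [enorm_mul, ENNReal.toReal_ofNat, ENNReal.mul_rpow_of_nonneg _ _ (by norm_num),
        ← mul_assoc]
      congr 1
      rw [← ofReal_norm, Complex.norm_real, Real.norm_of_nonneg (Real.sqrt_nonneg _),
        ENNReal.ofReal_rpow_of_nonneg (Real.sqrt_nonneg _) (by norm_num), Real.rpow_two,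
        Real.sq_sqrt (by positivity), ← ENNReal.ofReal_mul (by positivity)]
      congr 1
      field_simp
    · simp
  simp_rw [h1]
  rw [lintegral_indicator h.measurableSet, Measure.restrict_restrict h.measurableSet,
    inter_eq_left.2 h.subset]

theorem aestronglyMeasurable_pullback (h : IsBranch g J K) {u : ℝ → ℂ}
    (hu : AEStronglyMeasurable u (volume.restrict K)) :
    AEStronglyMeasurable (pullback g J u) circleMeasure := by
  refine AEStronglyMeasurable.mono_ac
    (circleMeasure_ac.1.trans Measure.absolutelyContinuous_restrict) ?_
  refine (aestronglyMeasurable_indicator_iff h.measurableSet).2 ?_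
  refine AEStronglyMeasurable.mul ?_ (hu.comp_quasiMeasurePreserving h.quasiMeasurePreserving)
  exact (Complex.continuous_ofReal.comp
    (continuous_const.mul h.continuous_deriv.abs).sqrt).aestronglyMeasurable

theorem memLp_pullback (h : IsBranch g J K) {u : ℝ → ℂ} (hu : MemLp u 2 (volume.restrict K)) :
    MemLp (pullback g J u) 2 circleMeasure :=
  ⟨h.aestronglyMeasurable_pullback hu.1, by rw [h.eLpNorm_pullback]; exact hu.2⟩

/-- The isometric embedding of `L²(g(J), dE)` into `L²([0, 2π], dk / 2π)` by weighted
composition with `g`. -/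
noncomputable def embed (h : IsBranch g J K) : IntervalL2 K →ₗᵢ[ℂ] CircleL2 where
  toFun u := (h.memLp_pullback (Lp.memLp u)).toLp _
  map_add' u v := by
    rw [← MemLp.toLp_add]
    refine MemLp.toLp_congr _ _ ?_
    refine (circleMeasure_ac.1.trans Measure.absolutelyContinuous_restrict).ae_le
      ((h.pullback_congr (Lp.coeFn_add u v)).trans (ae_of_all _ fun k => ?_))
    simp only [pullback, indicator, Pi.add_apply]
    split_ifs
    · exact mul_add _ _ _
    · exact (add_zero _).symm
  map_smul' c u := by
    rw [RingHom.id_apply, ← MemLp.toLp_const_smul]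
    refine MemLp.toLp_congr _ _ ?_
    refine (circleMeasure_ac.1.trans Measure.absolutelyContinuous_restrict).ae_le
      ((h.pullback_congr (Lp.coeFn_smul c u)).trans (ae_of_all _ fun k => ?_))
    simp only [pullback, indicator, Pi.smul_apply, smul_eq_mul]
    split_ifs
    · ring
    · exact (mul_zero _).symm
  norm_map' u := by
    change ‖(h.memLp_pullback (Lp.memLp u)).toLp _‖ = ‖u‖
    rw [Lp.norm_toLp, h.eLpNorm_pullback, Lp.norm_def]

theorem coeFn_embed (h : IsBranch g J K) (u : IntervalL2 K) :
    h.embed u =ᵐ[circleMeasure] pullback g J u :=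
  (h.memLp_pullback (Lp.memLp u)).coeFn_toLp

/-- Every square-integrable function supported on the branch `J` is a weighted composition with
`g`. -/
theorem exists_embed_eq (h : IsBranch g J K) (f : CircleL2)
    (hf : ∀ᵐ k ∂circleMeasure, k ∉ J → f k = 0) : ∃ u, h.embed u = f := by
  have hfm := (Lp.stronglyMeasurable f).measurable
  have he : MeasurableEmbedding (J.domRestrict g) :=
    h.differentiable.continuous.continuousOn.measurableEmbedding h.measurableSet h.injOn
  set φ : J → ℂ := fun k => f k / (Real.sqrt (2 * Real.pi * |deriv g k|) : ℂ) with hφ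
  have hφm : Measurable φ := by
    refine (hfm.comp measurable_subtype_coe).div ?_
    exact (Complex.continuous_ofReal.comp (continuous_const.mul
      (h.continuous_deriv.comp continuous_subtype_val).abs).sqrt).measurable
  set u : ℝ → ℂ := Function.extend (J.domRestrict g) φ 0 with hu
  have hum : Measurable u := he.measurable_extend hφm measurable_zero
  have hpull : pullback g J u =ᵐ[circleMeasure] f := by
    filter_upwards [hf] with k hk
    by_cases hkJ : k ∈ J
    · have h1 : u (g k) = φ ⟨k, hkJ⟩ := he.injective.extend_apply φ 0 ⟨k, hkJ⟩
      rw [pullback, indicator_of_mem hkJ, h1, hφ, mul_div_cancel₀ _ (h.sqrt_ne_zero hkJ)]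
    · rw [pullback, indicator_of_notMem hkJ, hk hkJ]
  have hum2 : MemLp u 2 (volume.restrict K) := by
    refine ⟨hum.aestronglyMeasurable, ?_⟩
    rw [← h.eLpNorm_pullback, eLpNorm_congr_ae hpull]
    exact (Lp.memLp f).2
  refine ⟨hum2.toLp u, ?_⟩
  apply Lp.ext
  refine (h.coeFn_embed _).trans (EventuallyEq.trans ?_ hpull)
  exact (circleMeasure_ac.1.trans Measure.absolutelyContinuous_restrict).ae_le
    (h.pullback_congr hum2.coeFn_toLp)

end IsBranch

/-! ### The unitary operator assembled from branches -/

section Unitary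

variable {n : ℕ} {g : ℝ → ℝ} {J K : Fin n → Set ℝ}

theorem inner_embed_eq_zero (h : ∀ j, IsBranch g (J j) (K j))
    (hJ : Pairwise fun i j => Disjoint (J i) (J j)) {i j : Fin n} (hij : i ≠ j)
    (u : IntervalL2 (K i)) (v : IntervalL2 (K j)) :
    ⟪(h i).embed u, (h j).embed v⟫_ℂ = 0 := by
  rw [L2.inner_def]
  refine integral_eq_zero_of_ae ?_
  filter_upwards [(h i).coeFn_embed u, (h j).coeFn_embed v] with k h1 h2
  rw [h1, h2]
  by_cases hk : k ∈ J i
  · rw [IsBranch.pullback.eq_1 g (J j), indicator_of_notMem (disjoint_left.1 (hJ hij) hk),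
      inner_zero_right]
    rfl
  · rw [IsBranch.pullback, indicator_of_notMem hk, inner_zero_left]
    rfl

/-- The isometry `(u_j) ↦ ∑ⱼ √(2π|g'|) u_j ∘ g 1_{J_j}`. -/
noncomputable def branchIsometry (h : ∀ j, IsBranch g (J j) (K j))
    (hJ : Pairwise fun i j => Disjoint (J i) (J j)) :
    PiLp 2 (fun j => IntervalL2 (K j)) →ₗᵢ[ℂ] CircleL2 where
  toFun u := ∑ j, (h j).embed (u j)
  map_add' u v := by
    simp only [PiLp.add_apply, map_add, Finset.sum_add_distrib]
  map_smul' c u := by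
    simp only [PiLp.smul_apply, map_smul, Finset.smul_sum, RingHom.id_apply]
  norm_map' u := by
    have hO : OrthogonalFamily ℂ (fun j => IntervalL2 (K j)) fun j => (h j).embed :=
      fun i j hij u v => inner_embed_eq_zero h hJ hij u v
    have h1 : ‖∑ j, (h j).embed (u j)‖ ^ 2 = ∑ j, ‖u j‖ ^ 2 := hO.norm_sum u Finset.univ
    rw [PiLp.norm_eq_of_L2, ← h1, Real.sqrt_sq (norm_nonneg _)]
    rfl

theorem coeFn_branchIsometry (h : ∀ j, IsBranch g (J j) (K j))
    (hJ : Pairwise fun i j => Disjoint (J i) (J j))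
    (u : PiLp 2 (fun j => IntervalL2 (K j))) :
    ∀ᵐ k ∂circleMeasure, ∀ j, k ∈ J j →
      branchIsometry h hJ u k = (Real.sqrt (2 * Real.pi * |deriv g k|) : ℂ) * u j (g k) := by
  have h1 : branchIsometry h hJ u =ᵐ[circleMeasure] fun k => ∑ j, (h j).embed (u j) k := by
    change ((∑ j, (h j).embed (u j) : CircleL2) : ℝ → ℂ) =ᵐ[circleMeasure] _
    exact Lp.coeFn_fun_finsetSum Finset.univ fun j => (h j).embed (u j)
  have h2 : ∀ᵐ k ∂circleMeasure, ∀ j, (h j).embed (u j) k = IsBranch.pullback g (J j) (u j) k :=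
    eventually_countable_forall.2 fun j => (h j).coeFn_embed (u j)
  filter_upwards [h1, h2] with k hk1 hk2 j hj
  rw [hk1, Finset.sum_eq_single j]
  · rw [hk2, IsBranch.pullback, indicator_of_mem hj]
  · intro i _ hij
    rw [hk2, IsBranch.pullback, indicator_of_notMem (disjoint_left.1 (hJ hij.symm) hj)]
  · exact fun h => absurd (Finset.mem_univ j) h

theorem branchIsometry_surjective (h : ∀ j, IsBranch g (J j) (K j))
    (hJ : Pairwise fun i j => Disjoint (J i) (J j)) (hcov : ∀ᵐ k ∂circleMeasure, ∃ j, k ∈ J j) :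
    Function.Surjective (branchIsometry h hJ) := by
  intro f
  have hf : ∀ j, MemLp ((J j).indicator f) 2 circleMeasure := fun j =>
    (Lp.memLp f).indicator (h j).measurableSet
  choose u hu using fun j => (h j).exists_embed_eq ((hf j).toLp _) (by
    filter_upwards [(hf j).coeFn_toLp] with k hk hkJ
    rw [hk, indicator_of_notMem hkJ])
  refine ⟨WithLp.toLp 2 u, ?_⟩
  apply Lp.ext
  have h2 : ∀ᵐ k ∂circleMeasure, ∀ j, (h j).embed (u j) k = (J j).indicator f k :=
    eventually_countable_forall.2 fun j => by
      rw [hu j]; exact (hf j).coeFn_toLp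
  have h3 : ∀ᵐ k ∂circleMeasure, ∀ j, (h j).embed (u j) k = IsBranch.pullback g (J j) (u j) k :=
    eventually_countable_forall.2 fun j => (h j).coeFn_embed (u j)
  filter_upwards [coeFn_branchIsometry h hJ (WithLp.toLp 2 u), hcov, h2, h3]
    with k h4 ⟨j, hj⟩ h5 h6
  rw [h4 j hj]
  have h7 := (h6 j).symm.trans (h5 j)
  rwa [IsBranch.pullback, indicator_of_mem hj, indicator_of_mem hj] at h7

/-- If the branches cover `[0, 2π]` up to a null set, the sum of the weighted compositions is
unitary. -/
noncomputable def branchUnitary (h : ∀ j, IsBranch g (J j) (K j))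
    (hJ : Pairwise fun i j => Disjoint (J i) (J j))
    (hcov : ∀ᵐ k ∂circleMeasure, ∃ j, k ∈ J j) :
    PiLp 2 (fun j => IntervalL2 (K j)) ≃ₗᵢ[ℂ] CircleL2 :=
  LinearIsometryEquiv.ofSurjective (branchIsometry h hJ) (branchIsometry_surjective h hJ hcov)

theorem coeFn_branchUnitary (h : ∀ j, IsBranch g (J j) (K j))
    (hJ : Pairwise fun i j => Disjoint (J i) (J j))
    (hcov : ∀ᵐ k ∂circleMeasure, ∃ j, k ∈ J j) (u : PiLp 2 (fun j => IntervalL2 (K j))) :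
    ∀ᵐ k ∂circleMeasure, ∀ j, k ∈ J j →
      branchUnitary h hJ hcov u k = (Real.sqrt (2 * Real.pi * |deriv g k|) : ℂ) * u j (g k) :=
  coeFn_branchIsometry h hJ u

theorem mem_graph_mulOp {μ : Measure ℝ} {φ : ℝ → ℝ} {p : Lp ℂ 2 μ × Lp ℂ 2 μ} :
    p ∈ (mulOp μ φ).graph ↔ p.2 =ᵐ[μ] fun x => (φ x : ℂ) * p.1 x := by
  rw [LinearPMap.mem_graph_iff]
  constructor
  · rintro ⟨y, hy, h⟩
    rw [← hy, ← h]
    exact MemLp.coeFn_toLp y.2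
  · intro h
    have hm : MemLp (fun x => (φ x : ℂ) * p.1 x) 2 μ := (Lp.memLp p.2).ae_eq h
    refine ⟨⟨p.1, hm⟩, rfl, ?_⟩
    apply Lp.ext
    exact (MemLp.coeFn_toLp hm).trans h.symm

theorem ae_circleMeasure_of_forall_branch (h : ∀ j, IsBranch g (J j) (K j))
    (hcov : ∀ᵐ k ∂circleMeasure, ∃ j, k ∈ J j) {p : ℝ → Prop}
    (hp : ∀ j, ∀ᵐ k ∂volume.restrict (J j), p k) : ∀ᵐ k ∂circleMeasure, p k := by
  have h1 : ∀ᵐ k ∂circleMeasure, ∀ j, k ∈ J j → p k :=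
    (circleMeasure_ac.1.trans Measure.absolutelyContinuous_restrict).ae_le
      (eventually_countable_forall.2 fun j => (ae_restrict_iff' (h j).measurableSet).1 (hp j))
  filter_upwards [h1, hcov] with k hk ⟨j, hj⟩
  exact hk j hj

/-- The unitary turns multiplication by the variable into multiplication by `g`. -/
theorem conj_branchUnitary_symm_mulOp (h : ∀ j, IsBranch g (J j) (K j))
    (hJ : Pairwise fun i j => Disjoint (J i) (J j))
    (hcov : ∀ᵐ k ∂circleMeasure, ∃ j, k ∈ J j) :
    conj (branchUnitary h hJ hcov).symm (mulOp circleMeasure g) =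
      directSum fun j => mulOp (volume.restrict (K j)) fun E => E := by
  apply LinearPMap.eq_of_eq_graph
  ext p
  rw [mem_graph_conj, LinearIsometryEquiv.symm_symm, mem_graph_mulOp, mem_graph_directSum]
  simp only [mem_graph_mulOp]
  have c1 := coeFn_branchUnitary h hJ hcov p.1
  have c2 := coeFn_branchUnitary h hJ hcov p.2
  constructor
  · intro hp j
    apply (h j).ae_of_ae_comp
    filter_upwards [(h j).ae_restrict_of_ae_circleMeasure hp,
      (h j).ae_restrict_of_ae_circleMeasure c1, (h j).ae_restrict_of_ae_circleMeasure c2,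
      ae_restrict_mem (h j).measurableSet] with k h1 h2 h3 hk
    rw [h3 j hk, h2 j hk] at h1
    refine mul_left_cancel₀ ((h j).sqrt_ne_zero hk) (h1.trans ?_)
    ring
  · intro hp
    apply ae_circleMeasure_of_forall_branch h hcov
    intro j
    filter_upwards [(h j).quasiMeasurePreserving.ae (hp j),
      (h j).ae_restrict_of_ae_circleMeasure c1, (h j).ae_restrict_of_ae_circleMeasure c2,
      ae_restrict_mem (h j).measurableSet] with k h1 h2 h3 hk
    rw [h3 j hk, h2 j hk, h1]
    ring

end Unitary

/-! ### The branches of `g` between consecutive critical points -/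

/-- `g` is a twice continuously differentiable `2π`-periodic function, and `a` enumerates in
increasing order the zeros of `g'` in `[0, 2π)`. -/
structure CriticalPoints (g : ℝ → ℝ) {n : ℕ} (a : Fin n → ℝ) : Prop where
  contDiff : ContDiff ℝ 2 g
  periodic : Function.Periodic g (2 * Real.pi)
  strictMono : StrictMono a
  zeros : {k : ℝ | k ∈ Ico 0 (2 * Real.pi) ∧ deriv g k = 0} = range a

/-- The points of `[0, 2π)` lying in the interval `(a_j, a_{j+1})` modulo `2π`. -/
def branchSet {n : ℕ} (a : Fin n → ℝ) (j : Fin n) : Set ℝ :=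
  {k | k ∈ Ico 0 (2 * Real.pi) ∧
    (k ∈ Ioo (a j) (nextZero a j) ∨ k + 2 * Real.pi ∈ Ioo (a j) (nextZero a j))}

namespace CriticalPoints

variable {g : ℝ → ℝ} {n : ℕ} {a : Fin n → ℝ}

theorem differentiable (h : CriticalPoints g a) : Differentiable ℝ g :=
  h.contDiff.differentiable (by norm_num)

theorem contDiff_deriv (h : CriticalPoints g a) : ContDiff ℝ 1 (deriv g) := by
  have h1 : ContDiff ℝ (1 + 1) g := by rw [one_add_one_eq_two]; exact h.contDiff
  exact (contDiff_succ_iff_deriv.1 h1).2.2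

theorem deriv_periodic (h : CriticalPoints g a) : Function.Periodic (deriv g) (2 * Real.pi) := by
  intro k
  rw [← deriv_comp_add_const]
  congr 1
  exact funext h.periodic

theorem deriv_deriv_periodic (h : CriticalPoints g a) :
    Function.Periodic (deriv (deriv g)) (2 * Real.pi) := by
  intro k
  rw [← deriv_comp_add_const]
  congr 1
  exact funext h.deriv_periodic

theorem mem_Ico (h : CriticalPoints g a) (j : Fin n) : a j ∈ Ico 0 (2 * Real.pi) :=
  ((Set.ext_iff.1 h.zeros (a j)).2 ⟨j, rfl⟩).1

theorem deriv_eq_zero (h : CriticalPoints g a) (j : Fin n) : deriv g (a j) = 0 :=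
  ((Set.ext_iff.1 h.zeros (a j)).2 ⟨j, rfl⟩).2

theorem exists_eq (h : CriticalPoints g a) {k : ℝ} (hk : k ∈ Ico 0 (2 * Real.pi))
    (h0 : deriv g k = 0) : ∃ j, a j = k :=
  (Set.ext_iff.1 h.zeros k).1 ⟨hk, h0⟩

theorem pos (h : CriticalPoints g a) : 0 < n := by
  obtain ⟨c, hc, hc0⟩ := exists_deriv_eq_zero Real.two_pi_pos
    h.differentiable.continuous.continuousOn (f := g) (by simpa using (h.periodic 0).symm)
  obtain ⟨j, -⟩ := h.exists_eq ⟨hc.1.le, hc.2⟩ hc0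
  exact j.pos

theorem lt_nextZero (h : CriticalPoints g a) (j : Fin n) : a j < nextZero a j := by
  unfold nextZero
  split_ifs with hj
  · exact h.strictMono (Fin.lt_def.2 (Nat.lt_succ_self _))
  · linarith [(h.mem_Ico j).2, (h.mem_Ico ⟨0, j.pos⟩).1]

theorem nextZero_le (h : CriticalPoints g a) (j : Fin n) :
    nextZero a j ≤ 2 * Real.pi + a ⟨0, j.pos⟩ := by
  unfold nextZero
  split_ifs with hj
  · linarith [(h.mem_Ico ⟨j + 1, hj⟩).2, (h.mem_Ico ⟨0, j.pos⟩).1]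
  · exact le_rfl

theorem nextZero_lt (h : CriticalPoints g a) (j : Fin n) : nextZero a j < 4 * Real.pi := by
  linarith [h.nextZero_le j, (h.mem_Ico ⟨0, j.pos⟩).2]

theorem nextZero_le_of_lt (h : CriticalPoints g a) {i j : Fin n} (hij : i < j) :
    nextZero a i ≤ a j := by
  have hij' := Fin.lt_def.1 hij
  have hi : (i : ℕ) + 1 < n := lt_of_le_of_lt hij' j.2
  rw [nextZero, dif_pos hi]
  exact h.strictMono.monotone (Fin.le_def.2 hij')

theorem deriv_nextZero (h : CriticalPoints g a) (j : Fin n) : deriv g (nextZero a j) = 0 := by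
  unfold nextZero
  split_ifs with hj
  · exact h.deriv_eq_zero _
  · rw [add_comm, h.deriv_periodic]
    exact h.deriv_eq_zero _

theorem deriv_ne_zero (h : CriticalPoints g a) (j : Fin n) {k : ℝ}
    (hk : k ∈ Ioo (a j) (nextZero a j)) : deriv g k ≠ 0 := by
  intro h0
  rcases lt_or_ge k (2 * Real.pi) with hk2 | hk2
  · obtain ⟨i, rfl⟩ := h.exists_eq ⟨(h.mem_Ico j).1.trans hk.1.le, hk2⟩ h0
    exact (h.nextZero_le_of_lt (h.strictMono.lt_iff_lt.1 hk.1)).not_gt hk.2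
  · have h1 := h.nextZero_le j
    obtain ⟨i, hi⟩ := h.exists_eq (k := k - 2 * Real.pi)
      ⟨by linarith, by linarith [hk.2, (h.mem_Ico ⟨0, j.pos⟩).2]⟩
      (by rw [h.deriv_periodic.sub_eq, h0])
    have h2 : a ⟨0, j.pos⟩ ≤ a i := h.strictMono.monotone (Fin.le_def.2 (Nat.zero_le _))
    linarith [hk.2]

theorem strictMonoOn_or_strictAntiOn (h : CriticalPoints g a) (j : Fin n) :
    (StrictMonoOn g (Icc (a j) (nextZero a j)) ∧ ∀ k ∈ Ioo (a j) (nextZero a j), 0 < deriv g k) ∨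
    (StrictAntiOn g (Icc (a j) (nextZero a j)) ∧
      ∀ k ∈ Ioo (a j) (nextZero a j), deriv g k < 0) := by
  have hc := h.differentiable.continuous.continuousOn (s := Icc (a j) (nextZero a j))
  rcases hasDerivWithinAt_forall_lt_or_forall_gt_of_forall_ne (convex_Ioo (a j) (nextZero a j))
    (fun k _ => (h.differentiable k).hasDerivAt.hasDerivWithinAt) (m := 0)
    (fun k hk => h.deriv_ne_zero j hk) with h1 | h1
  · exact Or.inr ⟨strictAntiOn_of_deriv_neg (convex_Icc _ _) hc (by rwa [interior_Icc]), h1⟩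
  · exact Or.inl ⟨strictMonoOn_of_deriv_pos (convex_Icc _ _) hc (by rwa [interior_Icc]), h1⟩

theorem injOn_Icc (h : CriticalPoints g a) (j : Fin n) : InjOn g (Icc (a j) (nextZero a j)) := by
  rcases h.strictMonoOn_or_strictAntiOn j with h1 | h1
  · exact h1.1.injOn
  · exact h1.1.injOn

theorem energyInterval_eq (h : CriticalPoints g a) (j : Fin n) :
    energyInterval g a j =
      Icc (min (g (a j)) (g (nextZero a j))) (max (g (a j)) (g (nextZero a j))) := by
  have hle := (h.lt_nextZero j).le
  have hc := h.differentiable.continuous.continuousOn (s := Icc (a j) (nextZero a j))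
  rcases h.strictMonoOn_or_strictAntiOn j with h1 | h1
  · have h2 := h1.1.monotoneOn (left_mem_Icc.2 hle) (right_mem_Icc.2 hle) hle
    rw [min_eq_left h2, max_eq_right h2]
    exact hc.image_Icc_of_monotoneOn hle h1.1.monotoneOn
  · have h2 := h1.1.antitoneOn (left_mem_Icc.2 hle) (right_mem_Icc.2 hle) hle
    rw [min_eq_right h2, max_eq_left h2]
    exact hc.image_Icc_of_antitoneOn hle h1.1.antitoneOn

theorem image_endpoints_lt (h : CriticalPoints g a) (j : Fin n) :
    min (g (a j)) (g (nextZero a j)) < max (g (a j)) (g (nextZero a j)) := by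
  have hlt := h.lt_nextZero j
  rw [min_lt_max]
  exact fun he => hlt.ne (h.injOn_Icc j (left_mem_Icc.2 hlt.le) (right_mem_Icc.2 hlt.le) he)

theorem image_branchSet (h : CriticalPoints g a) (j : Fin n) :
    g '' branchSet a j = g '' Ioo (a j) (nextZero a j) := by
  apply Subset.antisymm
  · rintro _ ⟨k, ⟨-, hk | hk⟩, rfl⟩
    · exact ⟨k, hk, rfl⟩
    · exact ⟨_, hk, h.periodic k⟩
  · rintro _ ⟨k, hk, rfl⟩
    rcases lt_or_ge k (2 * Real.pi) with hk2 | hk2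
    · exact ⟨k, ⟨⟨(h.mem_Ico j).1.trans hk.1.le, hk2⟩, Or.inl hk⟩, rfl⟩
    · refine ⟨k - 2 * Real.pi, ⟨⟨by linarith, by linarith [h.nextZero_lt j, hk.2]⟩, Or.inr ?_⟩,
        h.periodic.sub_eq k⟩
      rwa [sub_add_cancel]

theorem isBranch (h : CriticalPoints g a) (j : Fin n) :
    IsBranch g (branchSet a j) (energyInterval g a j) where
  differentiable := h.differentiable
  continuous_deriv := h.contDiff_deriv.continuous
  measurableSet := measurableSet_Ico.inter
    (measurableSet_Ioo.union (measurableSet_Ioo.preimage (measurable_id.add_const _)))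
  subset k hk := ⟨hk.1.1, hk.1.2.le⟩
  injOn := by
    have hsub := Ioo_subset_Icc_self (a := a j) (b := nextZero a j)
    have hinj := (h.injOn_Icc j).mono hsub
    rintro k ⟨hk0, hk | hk⟩ l ⟨hl0, hl | hl⟩ hkl
    · exact hinj hk hl hkl
    · rw [← h.periodic l] at hkl
      have := hinj hk hl hkl
      linarith [hk0.2, hl0.1]
    · rw [← h.periodic k] at hkl
      have := hinj hk hl hkl
      linarith [hk0.1, hl0.2]
    · rw [← h.periodic l, ← h.periodic k] at hkl
      have := hinj hk hl hkl
      linarith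
  deriv_ne_zero := by
    rintro k ⟨-, hk | hk⟩
    · exact h.deriv_ne_zero j hk
    · rw [← h.deriv_periodic]
      exact h.deriv_ne_zero j hk
  image_ae_eq := by
    rw [h.image_branchSet, energyInterval]
    refine EventuallyLE.antisymm (image_mono Ioo_subset_Icc_self).eventuallyLE ?_
    refine ae_le_set.2 (measure_mono_null (t := {g (a j), g (nextZero a j)}) ?_
      ((Set.toFinite _).measure_zero volume))
    rintro _ ⟨⟨k, hk, rfl⟩, hk'⟩
    rcases eq_or_lt_of_le hk.1 with h1 | h1
    · exact Or.inl (by rw [h1])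
    rcases eq_or_lt_of_le hk.2 with h2 | h2
    · exact Or.inr (by rw [h2]; rfl)
    · exact absurd ⟨k, ⟨h1, h2⟩, rfl⟩ hk'

theorem disjoint_branchSet (h : CriticalPoints g a) {i j : Fin n} (hij : i ≠ j) :
    Disjoint (branchSet a i) (branchSet a j) := by
  wlog hlt : i < j generalizing i j
  · exact (this hij.symm (lt_of_le_of_ne (not_lt.1 hlt) hij.symm)).symm
  rw [disjoint_left]
  have h1 := h.nextZero_le_of_lt hlt
  have h2 := h.nextZero_le j
  have h3 : a ⟨0, j.pos⟩ ≤ a i := h.strictMono.monotone (Fin.le_def.2 (Nat.zero_le _))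
  rintro k ⟨hk0, hk | hk⟩ ⟨-, hk' | hk'⟩
  · linarith [hk.2, hk'.1]
  · linarith [hk.1, hk'.2]
  · linarith [hk.2, hk'.1, Real.two_pi_pos]
  · linarith [hk.2, hk'.1]

theorem exists_mem_branchSet (h : CriticalPoints g a) {k : ℝ} (hk : k ∈ Ico 0 (2 * Real.pi))
    (h0 : deriv g k ≠ 0) : ∃ j, k ∈ branchSet a j := by
  have hne : ∀ i, a i ≠ k := fun i hi => h0 (hi ▸ h.deriv_eq_zero i)
  by_cases hex : ∃ i, a i < k
  · -- the last critical point before `k`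
    obtain ⟨j, hj, hmax⟩ := (Finset.univ.filter fun i => a i < k).exists_max_image id
      (hex.imp fun i hi => by simpa using hi)
    simp only [Finset.mem_filter, Finset.mem_univ, true_and, id] at hj hmax
    refine ⟨j, hk, Or.inl ⟨hj, ?_⟩⟩
    unfold nextZero
    split_ifs with hjn
    · by_contra hlt
      have h1 := hmax _ (lt_of_le_of_ne (not_lt.1 hlt) (hne _))
      exact absurd (Fin.le_def.1 h1) (by simp)
    · linarith [hk.2, (h.mem_Ico ⟨0, j.pos⟩).1]
  · -- `k` precedes all critical points, so `k + 2π` lies in the last interval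
    push Not at hex
    have hn := h.pos
    refine ⟨⟨n - 1, by omega⟩, hk, Or.inr ⟨?_, ?_⟩⟩
    · linarith [(h.mem_Ico ⟨n - 1, by omega⟩).2, hk.1]
    · rw [nextZero, dif_neg (by simp; omega)]
      linarith [lt_of_le_of_ne (hex ⟨0, hn⟩) (hne _).symm]

theorem ae_deriv_ne_zero (h : CriticalPoints g a) :
    ∀ᵐ k ∂circleMeasure, k ∈ Ico 0 (2 * Real.pi) ∧ deriv g k ≠ 0 := by
  rw [ae_circleMeasure_iff]
  have h1 : ∀ᵐ k : ℝ, k ∉ range a :=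
    measure_eq_zero_iff_ae_notMem.1 ((finite_range a).measure_zero volume)
  have h2 : ∀ᵐ k : ℝ, k ≠ 2 * Real.pi := by simp [ae_iff, measure_singleton]
  filter_upwards [h1, h2] with k hk1 hk2 hk
  have hk' : k ∈ Ico 0 (2 * Real.pi) := ⟨hk.1, lt_of_le_of_ne hk.2 hk2⟩
  exact ⟨hk', fun h0 => hk1 (h.exists_eq hk' h0)⟩

theorem ae_exists_mem_branchSet (h : CriticalPoints g a) :
    ∀ᵐ k ∂circleMeasure, ∃ j, k ∈ branchSet a j := by
  filter_upwards [h.ae_deriv_ne_zero] with k hk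
  exact h.exists_mem_branchSet hk.1 hk.2

/-- The unitary operator `V⁻¹` sending `(u_j)` to the function that equals
`√(2π|g'|) u_j ∘ g` on the `j`-th branch. -/
noncomputable def unitary (h : CriticalPoints g a) :
    PiLp 2 (fun j => IntervalL2 (energyInterval g a j)) ≃ₗᵢ[ℂ] CircleL2 :=
  branchUnitary h.isBranch (fun _ _ hij => h.disjoint_branchSet hij) h.ae_exists_mem_branchSet

theorem coeFn_unitary (h : CriticalPoints g a)
    (u : PiLp 2 (fun j => IntervalL2 (energyInterval g a j))) :
    ∀ᵐ k ∂circleMeasure, ∀ j, k ∈ branchSet a j →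
      h.unitary u k = (Real.sqrt (2 * Real.pi * |deriv g k|) : ℂ) * u j (g k) :=
  coeFn_branchUnitary _ _ _ u

end CriticalPoints

/-! ### The graph of the time operator -/

section Abstract

variable {E : Type*} [NormedAddCommGroup E] [InnerProductSpace ℂ E]

theorem mem_graph_opMul {A B : E →ₗ.[ℂ] E} {p : E × E} :
    p ∈ (opMul B A).graph ↔ ∃ q, (p.1, q) ∈ A.graph ∧ (q, p.2) ∈ B.graph := by
  simp only [LinearPMap.mem_graph_iff]
  constructor
  · rintro ⟨x, hx, h⟩
    exact ⟨A ⟨x, x.2.1⟩, ⟨⟨x, x.2.1⟩, hx, rfl⟩, ⟨⟨A ⟨x, x.2.1⟩, x.2.2⟩, rfl, h⟩⟩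
  · rintro ⟨q, ⟨x, hx, rfl⟩, ⟨y, hy, h⟩⟩
    have hm : ∃ hx : (x : E) ∈ A.domain, A ⟨x, hx⟩ ∈ B.domain := ⟨x.2, hy ▸ y.2⟩
    refine ⟨⟨x, hm⟩, hx, ?_⟩
    rw [← h]
    exact congrArg B (Subtype.ext hy.symm)

theorem mem_graph_add {A B : E →ₗ.[ℂ] E} {p : E × E} :
    p ∈ (A + B).graph ↔ ∃ u v, (p.1, u) ∈ A.graph ∧ (p.1, v) ∈ B.graph ∧ u + v = p.2 := by
  simp only [LinearPMap.mem_graph_iff]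
  constructor
  · rintro ⟨x, hx, h⟩
    exact ⟨A ⟨x, x.2.1⟩, B ⟨x, x.2.2⟩, ⟨⟨x, x.2.1⟩, hx, rfl⟩, ⟨⟨x, x.2.2⟩, hx, rfl⟩, h⟩
  · rintro ⟨u, v, ⟨x, hx, rfl⟩, ⟨y, hy, rfl⟩, h⟩
    refine ⟨⟨x, x.2, by rw [hx, ← hy]; exact y.2⟩, hx, ?_⟩
    rw [← h]
    change A _ + B _ = _
    congr 1
    exact congrArg B (Subtype.ext (hx.trans hy.symm))

theorem mem_graph_smul {A : E →ₗ.[ℂ] E} {c : ℂ} {p : E × E} :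
    p ∈ (c • A).graph ↔ ∃ u, (p.1, u) ∈ A.graph ∧ c • u = p.2 := by
  simp only [LinearPMap.mem_graph_iff]
  constructor
  · rintro ⟨x, hx, h⟩
    exact ⟨A x, ⟨x, hx, rfl⟩, h⟩
  · rintro ⟨u, ⟨x, hx, rfl⟩, h⟩
    exact ⟨x, hx, h⟩

end Abstract

theorem mem_graph_timeOp_iff_exists {g : ℝ → ℝ} {p : CircleL2 × CircleL2} :
    p ∈ (timeOp g).graph ↔ ∃ d s q r : CircleL2,
      (p.1, d) ∈ periodicMomentum.graph ∧
      s =ᵐ[circleMeasure] (fun k => ((1 / deriv g k : ℝ) : ℂ) * d k) ∧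
      q =ᵐ[circleMeasure] (fun k => ((1 / deriv g k : ℝ) : ℂ) * p.1 k) ∧
      (q, r) ∈ periodicMomentum.graph ∧
      (-(1 / 2) : ℂ) • (s + r) = p.2 := by
  simp only [timeOp, mem_graph_smul, mem_graph_add, mem_graph_opMul, mem_graph_mulOp]
  constructor
  · rintro ⟨_, ⟨s, r, ⟨d, h1, h2⟩, ⟨q, h3, h4⟩, rfl⟩, h⟩
    exact ⟨d, s, q, r, h1, h2, h3, h4, h⟩
  · rintro ⟨d, s, q, r, h1, h2, h3, h4, h⟩
    exact ⟨_, ⟨s, r, ⟨d, h1, h2⟩, ⟨q, h3, h4⟩, rfl⟩, h⟩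

theorem memLp_circleMeasure_of_continuousOn {f : ℝ → ℂ}
    (hf : ContinuousOn f (Icc 0 (2 * Real.pi))) : MemLp f 2 circleMeasure := by
  rw [circleMeasure]
  exact (memLp_of_continuousOn hf).smul_measure ENNReal.ofReal_ne_top

namespace CriticalPoints

variable {g : ℝ → ℝ} {n : ℕ} {a : Fin n → ℝ}

theorem contDiff_ofReal_deriv (h : CriticalPoints g a) :
    ContDiff ℝ 1 fun k => ((deriv g k : ℝ) : ℂ) :=
  Complex.ofRealCLM.contDiff.comp h.contDiff_deriv

theorem hasDerivAt_ofReal_deriv (h : CriticalPoints g a) (k : ℝ) :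
    HasDerivAt (fun k => ((deriv g k : ℝ) : ℂ)) ((deriv (deriv g) k : ℝ) : ℂ) k :=
  (h.contDiff_deriv.differentiable one_ne_zero k).hasDerivAt.ofReal_comp

theorem continuous_deriv_deriv (h : CriticalPoints g a) : Continuous (deriv (deriv g)) :=
  h.contDiff_deriv.continuous_deriv le_rfl

/-- The elements of the domain of `T` are the `g' y` with `y` in the domain of `P` and
`(g'' / g') y` square-integrable, and `T (g' y) = (i/2) (g'' / g') y - P y`. -/
theorem mem_graph_timeOp (h : CriticalPoints g a) {p : CircleL2 × CircleL2} :
    p ∈ (timeOp g).graph ↔ ∃ (y : ℝ → ℂ) (r : CircleL2),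
      AbsolutelyContinuousOnInterval y 0 (2 * Real.pi) ∧ y 0 = y (2 * Real.pi) ∧
      (∀ᵐ k ∂circleMeasure, HasDerivAt y (Complex.I * r k) k) ∧
      (p.1 =ᵐ[circleMeasure] fun k => ((deriv g k : ℝ) : ℂ) * y k) ∧
      (p.2 =ᵐ[circleMeasure] fun k =>
        Complex.I / 2 * (deriv (deriv g) k / deriv g k * y k) - r k) := by
  have hpi : (0 : ℝ) ≤ 2 * Real.pi := Real.two_pi_pos.le
  rw [mem_graph_timeOp_iff_exists]
  constructor
  · rintro ⟨d, s, q, r, hd, hs, hq, hr, hw⟩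
    obtain ⟨φ, hφ, -, hφ1, hφ2⟩ := (mem_periodicMomentum_graph _).1 hd
    obtain ⟨y, hy, hyb, hy1, hy2⟩ := (mem_periodicMomentum_graph _).1 hr
    have hpy : p.1 =ᵐ[circleMeasure] fun k => ((deriv g k : ℝ) : ℂ) * y k := by
      filter_upwards [hq, hy1, h.ae_deriv_ne_zero] with k h1 h2 h3
      rw [← h2, h1, ← mul_assoc, ← Complex.ofReal_mul, mul_one_div_cancel h3.2,
        Complex.ofReal_one, one_mul]
    -- The continuous representatives of `f` and `g' y` agree, so they have the same derivative.
    have hEq : EqOn φ (fun k => ((deriv g k : ℝ) : ℂ) * y k) (Ioo 0 (2 * Real.pi)) := by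
      refine Measure.eqOn_open_of_ae_eq (μ := volume) ?_ isOpen_Ioo ?_ ?_
      · rw [Measure.restrict_congr_set Ioo_ae_eq_Icc]
        exact circleMeasure_ac.2.ae_le (hφ1.symm.trans hpy)
      · exact hφ.continuousOn.mono (by rw [uIcc_of_le hpi]; exact Ioo_subset_Icc_self)
      · exact h.contDiff_ofReal_deriv.continuous.continuousOn.mul
          (hy.continuousOn.mono (by rw [uIcc_of_le hpi]; exact Ioo_subset_Icc_self))
    have hmem : ∀ᵐ k ∂circleMeasure, k ∈ Ioo 0 (2 * Real.pi) := by
      apply circleMeasure_ac.1.ae_le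
      rw [← Measure.restrict_congr_set Ioo_ae_eq_Icc]
      exact ae_restrict_mem measurableSet_Ioo
    refine ⟨y, r, hy, hyb, hy2, hpy, ?_⟩
    rw [← hw]
    filter_upwards [Lp.coeFn_smul (-(1 / 2) : ℂ) (s + r), Lp.coeFn_add s r, hs, hφ2, hy2, hmem,
      h.ae_deriv_ne_zero] with k h1 h2 h3 h4 h5 h6 h7
    have h8 : HasDerivAt φ (deriv (deriv g) k * y k + deriv g k * (Complex.I * r k)) k := by
      refine ((h.hasDerivAt_ofReal_deriv k).mul h5).congr_of_eventuallyEq ?_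
      filter_upwards [isOpen_Ioo.mem_nhds h6] with l hl using hEq hl
    have h9 := h4.unique h8
    have h10 : ((deriv g k : ℝ) : ℂ) ≠ 0 := Complex.ofReal_ne_zero.2 h7.2
    rw [h1, Pi.smul_apply, h2, Pi.add_apply, h3, smul_eq_mul]
    have h11 : d k = -Complex.I * (deriv (deriv g) k * y k) + deriv g k * r k := by
      linear_combination (-Complex.I) * h9 + (d k - ((deriv g k : ℝ) : ℂ) * r k) * Complex.I_mul_I
    rw [h11]
    push_cast
    field_simp
    ring
  · rintro ⟨y, r, hy, hyb, hy2, hpy, hw⟩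
    have hyL : MemLp y 2 circleMeasure :=
      memLp_circleMeasure_of_continuousOn (by simpa [uIcc_of_le hpi] using hy.continuousOn)
    obtain ⟨d, hd⟩ : ∃ d : CircleL2, d =ᵐ[circleMeasure] fun k =>
        -Complex.I * (deriv (deriv g) k * y k) + deriv g k * r k := by
      have hL1 : MemLp (fun k => -Complex.I * (deriv (deriv g) k * y k)) 2 circleMeasure := by
        refine memLp_circleMeasure_of_continuousOn (continuousOn_const.mul (ContinuousOn.mul
          (Complex.continuous_ofReal.comp h.continuous_deriv_deriv).continuousOn ?_))
        simpa [uIcc_of_le hpi] using hy.continuousOn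
      have hL2 : MemLp (fun k => ((deriv g k : ℝ) : ℂ) * r k) 2 circleMeasure := by
        obtain ⟨C, hC⟩ := (isCompact_Icc (a := 0) (b := 2 * Real.pi)).exists_bound_of_continuousOn
          h.contDiff_ofReal_deriv.continuous.continuousOn
        refine (Lp.memLp r).of_le_mul (c := C)
          (h.contDiff_ofReal_deriv.continuous.aestronglyMeasurable.mul (Lp.memLp r).1) ?_
        rw [ae_circleMeasure_iff]
        refine ae_of_all _ fun k hk => ?_
        rw [norm_mul]
        exact mul_le_mul_of_nonneg_right (hC k hk) (norm_nonneg _)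
      exact ⟨(hL1.add hL2).toLp _, (hL1.add hL2).coeFn_toLp⟩
    refine ⟨d, (-2 : ℂ) • p.2 - r, hyL.toLp y, r, (mem_periodicMomentum_graph _).2
      ⟨fun k => ((deriv g k : ℝ) : ℂ) * y k, ?_, ?_, hpy, ?_⟩, ?_, ?_,
      (mem_periodicMomentum_graph _).2 ⟨y, hy, hyb, hyL.coeFn_toLp, hy2⟩, ?_⟩
    · simpa using! (absolutelyContinuousOnInterval_of_contDiff h.contDiff_ofReal_deriv 0
        (2 * Real.pi)).smul hy
    · have := h.deriv_periodic 0
      rw [zero_add] at this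
      simp only [this, hyb]
    · filter_upwards [hy2, hd] with k h1 h2
      refine ((h.hasDerivAt_ofReal_deriv k).mul h1).congr_deriv ?_
      simp only [h2]
      linear_combination (((deriv (deriv g) k : ℝ) : ℂ) * y k) * Complex.I_mul_I
    · filter_upwards [hd, hw, Lp.coeFn_sub ((-2 : ℂ) • p.2) r, Lp.coeFn_smul (-2 : ℂ) p.2,
        h.ae_deriv_ne_zero] with k h1 h2 h3 h4 h5
      have h10 : ((deriv g k : ℝ) : ℂ) ≠ 0 := Complex.ofReal_ne_zero.2 h5.2
      rw [h3, Pi.sub_apply, h4, Pi.smul_apply, h2, h1, smul_eq_mul]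
      push_cast
      field_simp
      ring
    · filter_upwards [hyL.coeFn_toLp, hpy, h.ae_deriv_ne_zero] with k h1 h2 h3
      rw [h1, h2, ← mul_assoc, ← Complex.ofReal_mul, one_div_mul_cancel h3.2,
        Complex.ofReal_one, one_mul]
    · module

end CriticalPoints

/-! ### The time operator is contained in the transported momentum operators -/

/-- The signed square root `t / √(2π|t|)`, written so that its continuity at `0` is plain. -/
noncomputable def signedSqrt (t : ℝ) : ℝ := (√t - √(-t)) / √(2 * Real.pi)

theorem continuous_signedSqrt : Continuous signedSqrt := by
  unfold signedSqrt
  fun_prop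

theorem signedSqrt_mul_sqrt (t : ℝ) : signedSqrt t * √(2 * Real.pi * |t|) = t := by
  have h2 : √(2 * Real.pi) ≠ 0 := by positivity
  rw [signedSqrt, Real.sqrt_mul Real.two_pi_pos.le]
  rcases le_total 0 t with h | h
  · rw [abs_of_nonneg h, Real.sqrt_eq_zero_of_nonpos (neg_nonpos.2 h), sub_zero]
    field_simp
    exact Real.sq_sqrt h
  · rw [abs_of_nonpos h, Real.sqrt_eq_zero_of_nonpos h, zero_sub]
    field_simp
    rw [Real.sq_sqrt (neg_nonneg.2 h), neg_neg]

theorem signedSqrt_zero : signedSqrt 0 = 0 := by simp [signedSqrt]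

theorem signedSqrt_ne_zero {t : ℝ} (ht : t ≠ 0) : signedSqrt t ≠ 0 := fun h => by
  have := signedSqrt_mul_sqrt t
  rw [h, zero_mul] at this
  exact ht this.symm

theorem contDiffAt_signedSqrt {t : ℝ} (ht : t ≠ 0) : ContDiffAt ℝ 1 signedSqrt t := by
  have h1 : ContDiffAt ℝ 1 Real.sqrt t := Real.contDiffAt_sqrt ht
  have h2 : ContDiffAt ℝ 1 (fun t => √(-t)) t := contDiffAt_id.neg.sqrt (neg_ne_zero.2 ht)
  exact (h1.sub h2).div_const _

theorem hasDerivAt_signedSqrt {t : ℝ} (ht : t ≠ 0) :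
    HasDerivAt signedSqrt (1 / (2 * √(2 * Real.pi * |t|))) t := by
  have h2 : √(2 * Real.pi) ≠ 0 := by positivity
  have h1 : HasDerivAt signedSqrt ((1 / (2 * √t) - -1 / (2 * √(-t))) / √(2 * Real.pi)) t :=
    ((Real.hasDerivAt_sqrt ht).sub ((hasDerivAt_neg t).sqrt (neg_ne_zero.2 ht))).div_const _
  refine h1.congr_deriv ?_
  rw [Real.sqrt_mul Real.two_pi_pos.le]
  rcases le_total 0 t with h | h
  · rw [abs_of_nonneg h, Real.sqrt_eq_zero_of_nonpos (neg_nonpos.2 h)]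
    simp
    ring
  · rw [abs_of_nonpos h, Real.sqrt_eq_zero_of_nonpos h]
    simp
    ring

/-- An absolutely continuous function on `[0, 2π]` with equal boundary values extends to a
`2π`-periodic function that is absolutely continuous on every interval. -/
theorem exists_periodic_extension {y : ℝ → ℂ} {r : CircleL2}
    (hy : AbsolutelyContinuousOnInterval y 0 (2 * Real.pi)) (hyb : y 0 = y (2 * Real.pi))
    (hr : ∀ᵐ k ∂circleMeasure, HasDerivAt y (Complex.I * r k) k) :
    ∃ Y ψ : ℝ → ℂ, Function.Periodic Y (2 * Real.pi) ∧ Function.Periodic ψ (2 * Real.pi) ∧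
      Continuous Y ∧ (∀ c d, AbsolutelyContinuousOnInterval Y c d) ∧
      (∀ᵐ k, HasDerivAt Y (ψ k) k) ∧ (∀ k ∈ Icc 0 (2 * Real.pi), Y k = y k) ∧
      ∀ᵐ k ∂circleMeasure, ψ k = Complex.I * r k := by
  have hpi := Real.two_pi_pos
  set ψ : ℝ → ℂ := fun k => Complex.I * r (toIcoMod hpi 0 k) with hψ
  have hψp : Function.Periodic ψ (2 * Real.pi) := fun k => by
    simp only [hψ, toIcoMod_add_right]
  have hψr : ∀ᵐ k ∂circleMeasure, ψ k = Complex.I * r k := by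
    rw [ae_circleMeasure_iff]
    have h2 : ∀ᵐ k : ℝ, k ≠ 2 * Real.pi := by simp [ae_iff, measure_singleton]
    filter_upwards [h2] with k hk2 hk
    simp only [hψ]
    rw [(toIcoMod_eq_self hpi).2 ⟨hk.1, by rw [zero_add]; exact lt_of_le_of_ne hk.2 hk2⟩]
  have hri : IntervalIntegrable (fun k => Complex.I * r k) volume 0 (2 * Real.pi) := by
    rw [intervalIntegrable_iff_integrableOn_Icc_of_le hpi.le]
    have h1 : Integrable (fun k => Complex.I * r k)
        (ENNReal.ofReal (1 / (2 * Real.pi)) • volume.restrict (Icc 0 (2 * Real.pi))) := by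
      have : IsFiniteMeasure circleMeasure := by
        unfold circleMeasure
        exact Measure.smul_finite _ ENNReal.ofReal_ne_top
      exact ((Lp.memLp r).integrable (by norm_num)).const_mul _
    exact (integrable_smul_measure (by rw [Ne, ENNReal.ofReal_eq_zero, not_le]; positivity)
      ENNReal.ofReal_ne_top).1 h1
  have hψr' : ∀ᵐ k, k ∈ uIoc 0 (2 * Real.pi) → ψ k = Complex.I * r k := by
    filter_upwards [ae_circleMeasure_iff.1 hψr] with k hk hk'
    rw [uIoc_of_le hpi.le] at hk'
    exact hk ⟨hk'.1.le, hk'.2⟩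
  have hψi : ∀ c d, IntervalIntegrable ψ volume c d := by
    refine hψp.intervalIntegrable (t := 0) hpi.ne' ?_
    rw [zero_add]
    refine hri.congr_ae ?_
    rw [EventuallyEq, ae_restrict_iff' measurableSet_uIoc]
    filter_upwards [hψr'] with k hk hk' using (hk hk').symm
  set Y : ℝ → ℂ := fun x => y 0 + ∫ t in 0..x, ψ t with hY
  have hYy : ∀ k ∈ Icc 0 (2 * Real.pi), Y k = y k := by
    intro k hk
    rw [hy.eq_add_intervalIntegral hpi.le hri (ae_circleMeasure_iff.1 hr) hk]
    simp only [hY]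
    congr 1
    refine intervalIntegral.integral_congr_ae ?_
    filter_upwards [hψr'] with t h1 h2
    rw [uIoc_of_le hk.1] at h2
    exact h1 (by rw [uIoc_of_le hpi.le]; exact ⟨h2.1, h2.2.trans hk.2⟩)
  have hac : ∀ c d, AbsolutelyContinuousOnInterval Y c d := by
    intro c d
    have h1 := (absolutelyContinuousOnInterval_of_contDiff
      (contDiff_const (c := y 0 + ∫ t in 0..c, ψ t)) c d).add
      (absolutelyContinuousOnInterval_intervalIntegral (hψi c d) left_mem_uIcc)
    refine h1.congr fun x _ => ?_
    simp only [hY, Pi.add_apply]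
    rw [add_assoc, intervalIntegral.integral_add_adjacent_intervals (hψi 0 c) (hψi c x)]
  refine ⟨Y, ψ, ?_, hψp, ?_, hac, ?_, hYy, hψr⟩
  · intro x
    have h1 : ∫ t in x..x + 2 * Real.pi, ψ t = 0 := by
      rw [hψp.intervalIntegral_add_eq x 0, zero_add]
      have h2 := hYy _ (right_mem_Icc.2 hpi.le)
      simp only [hY, ← hyb] at h2
      simpa using h2
    simp only [hY]
    rw [← intervalIntegral.integral_add_adjacent_intervals (hψi 0 x) (hψi x _), h1, add_zero]
  · exact continuous_const.add (intervalIntegral.continuous_primitive hψi 0)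
  · have hloc : LocallyIntegrable ψ volume := by
      intro x
      refine ⟨Icc (x - 1) (x + 1), Icc_mem_nhds (by linarith) (by linarith), ?_⟩
      exact (intervalIntegrable_iff_integrableOn_Icc_of_le (by linarith)).1 (hψi _ _)
    filter_upwards [LocallyIntegrable.ae_hasDerivAt_integral hloc] with x hx
    exact (hx 0).const_add _

namespace CriticalPoints

variable {g : ℝ → ℝ} {n : ℕ} {a : Fin n → ℝ}

theorem ae_energyInterval (h : CriticalPoints g a) (j : Fin n) {p : ℝ → Prop}
    (hp : ∀ᵐ k, k ∈ Ioo (a j) (nextZero a j) → p (g k)) :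
    ∀ᵐ E ∂volume.restrict (energyInterval g a j), p E := by
  apply (h.isBranch j).ae_of_ae_comp
  rw [ae_restrict_iff' (h.isBranch j).measurableSet]
  filter_upwards [hp, (measurePreserving_add_right volume (2 * Real.pi)).quasiMeasurePreserving.ae
    hp] with k h1 h2 hk
  rcases hk.2 with hk | hk
  · exact h1 hk
  · rw [← h.periodic k]
    exact h2 hk

theorem ae_Ioo_of_ae_circleMeasure (h : CriticalPoints g a) (j : Fin n) {p : ℝ → Prop}
    (hper : ∀ k, p (k - 2 * Real.pi) → p k)
    (hp : ∀ᵐ k ∂circleMeasure, k ∈ branchSet a j → p k) :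
    ∀ᵐ k, k ∈ Ioo (a j) (nextZero a j) → p k := by
  rw [ae_circleMeasure_iff] at hp
  filter_upwards [hp, (measurePreserving_sub_right volume (2 * Real.pi)).quasiMeasurePreserving.ae
    hp] with k h1 h2 hk
  rcases lt_or_ge k (2 * Real.pi) with hk2 | hk2
  · have h3 : k ∈ Ico 0 (2 * Real.pi) := ⟨(h.mem_Ico j).1.trans hk.1.le, hk2⟩
    exact h1 ⟨h3.1, h3.2.le⟩ ⟨h3, Or.inl hk⟩
  · have h3 : k - 2 * Real.pi ∈ Ico 0 (2 * Real.pi) :=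
      ⟨by linarith, by linarith [h.nextZero_lt j, hk.2]⟩
    exact hper k (h2 ⟨h3.1, h3.2.le⟩ ⟨h3, Or.inr (by rwa [sub_add_cancel])⟩)

theorem intervalIntegral_comp (h : CriticalPoints g a) (j : Fin n) {c x : ℝ} (hac : a j ≤ c)
    (hcx : c ≤ x) (hx : x ≤ nextZero a j) (w : ℝ → ℂ) :
    ∫ E in g c..g x, w E = ∫ k in c..x, ((deriv g k : ℝ) : ℂ) * w (g k) := by
  have hsub : Icc c x ⊆ Icc (a j) (nextZero a j) := Icc_subset_Icc hac hx
  have hd : ∀ k ∈ Icc c x, HasDerivWithinAt g (deriv g k) (Icc c x) k :=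
    fun k _ => (h.differentiable k).hasDerivAt.hasDerivWithinAt
  have hc := h.differentiable.continuous.continuousOn (s := Icc c x)
  rw [← integral_restrict_Icc hcx]
  rcases h.strictMonoOn_or_strictAntiOn j with h1 | h1
  · have h2 := (h1.1.mono hsub).monotoneOn
    rw [← integral_restrict_Icc (h2 (left_mem_Icc.2 hcx) (right_mem_Icc.2 hcx) hcx),
      ← hc.image_Icc_of_monotoneOn hcx h2,
      integral_image_eq_integral_deriv_smul_of_monotoneOn measurableSet_Icc hd h2]
    simp only [Complex.real_smul]
  · have h2 := (h1.1.mono hsub).antitoneOn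
    rw [intervalIntegral.integral_symm,
      ← integral_restrict_Icc (h2 (left_mem_Icc.2 hcx) (right_mem_Icc.2 hcx) hcx),
      ← hc.image_Icc_of_antitoneOn hcx h2,
      integral_image_eq_integral_deriv_smul_of_antitoneOn measurableSet_Icc hd h2, ← integral_neg]
    simp only [Complex.real_smul, Complex.ofReal_neg, neg_mul, neg_neg]

theorem intervalIntegrable_comp (h : CriticalPoints g a) (j : Fin n) {c x : ℝ} (hac : a j ≤ c)
    (hcx : c ≤ x) (hx : x ≤ nextZero a j) {w : ℝ → ℂ}
    (hw : IntegrableOn w (energyInterval g a j)) :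
    IntervalIntegrable (fun k => ((deriv g k : ℝ) : ℂ) * w (g k)) volume c x := by
  have hsub : Icc c x ⊆ Icc (a j) (nextZero a j) := Icc_subset_Icc hac hx
  have hd : ∀ k ∈ Icc c x, HasDerivWithinAt g (deriv g k) (Icc c x) k :=
    fun k _ => (h.differentiable k).hasDerivAt.hasDerivWithinAt
  have hw' : IntegrableOn w (g '' Icc c x) := hw.mono_set (image_mono hsub)
  rw [intervalIntegrable_iff_integrableOn_Icc_of_le hcx]
  rcases h.strictMonoOn_or_strictAntiOn j with h1 | h1
  · have h2 := (h1.1.mono hsub).monotoneOn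
    have h3 := (integrableOn_image_iff_integrableOn_deriv_smul_of_monotoneOn measurableSet_Icc hd
      h2 w).1 hw'
    simpa only [Complex.real_smul] using h3
  · have h2 := (h1.1.mono hsub).antitoneOn
    have h3 := ((integrableOn_image_iff_integrableOn_deriv_smul_of_antitoneOn measurableSet_Icc hd
      h2 w).1 hw').neg
    refine h3.congr_fun (fun k _ => ?_) measurableSet_Icc
    simp [Complex.real_smul]

/-- A function `u` on an energy interval belongs to the domain of `P_j` as soon as `u ∘ g` is
locally absolutely continuous between the critical points and tends to `0` at them, with
square-integrable derivative in the energy variable. -/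
theorem mem_graph_of_comp (h : CriticalPoints g a) (j : Fin n)
    {u v : IntervalL2 (energyInterval g a j)} {G : ℝ → ℂ}
    (hG : ContinuousOn G (Icc (a j) (nextZero a j))) (hGa : G (a j) = 0)
    (hGb : G (nextZero a j) = 0)
    (hac : ∀ c d, a j < c → c ≤ d → d < nextZero a j → AbsolutelyContinuousOnInterval G c d)
    (hder : ∀ᵐ k, k ∈ Ioo (a j) (nextZero a j) →
      HasDerivAt G (((deriv g k : ℝ) : ℂ) * (-Complex.I * v (g k))) k)
    (hu : ∀ᵐ k, k ∈ Ioo (a j) (nextZero a j) → u (g k) = G k) :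
    (u, v) ∈ (-dirichletMomentum (energyInterval g a j)).graph := by
  have hlt := h.lt_nextZero j
  have hK := h.energyInterval_eq j
  set m := min (g (a j)) (g (nextZero a j)) with hm
  set M := max (g (a j)) (g (nextZero a j)) with hM
  have hmM : m < M := h.image_endpoints_lt j
  have hae := fun {p : ℝ → Prop} => h.ae_energyInterval j (p := p)
  have hcov := fun {c x : ℝ} => h.intervalIntegral_comp j (c := c) (x := x)
  have hint := fun {c x : ℝ} (h1 : a j ≤ c) (h2 : c ≤ x) (h3 : x ≤ nextZero a j) {w : ℝ → ℂ} =>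
    h.intervalIntegrable_comp j h1 h2 h3 (w := w)
  have hmaps : MapsTo g (Icc (a j) (nextZero a j)) (energyInterval g a j) := mapsTo_image _ _
  generalize energyInterval g a j = K at *
  subst hK
  have hwi : IntegrableOn (fun E => -Complex.I * v E) (Icc m M) :=
    ((Lp.memLp v).integrable (by norm_num)).const_mul _
  have hwi' : IntervalIntegrable (fun E => -Complex.I * v E) volume m M :=
    (intervalIntegrable_iff_integrableOn_Icc_of_le hmM.le).2 hwi
  have hwii : ∀ c ∈ Icc m M, ∀ d ∈ Icc m M,
      IntervalIntegrable (fun E => -Complex.I * v E) volume c d := fun c hc d hd => by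
    rw [← uIcc_of_le hmM.le] at hc hd
    exact hwi'.mono_set (uIcc_subset_uIcc hc hd)
  set U : ℝ → ℂ := fun E => ∫ t in m..E, -Complex.I * v t with hU
  have hUac : AbsolutelyContinuousOnInterval U m M :=
    absolutelyContinuousOnInterval_intervalIntegral hwi' left_mem_uIcc
  have hUc : ContinuousOn U (Icc m M) := by
    have := hUac.continuousOn
    rwa [uIcc_of_le hmM.le] at this
  -- `G - U ∘ g` has zero derivative, so it is constant between the critical points.
  have hstep : ∀ c d, a j < c → c ≤ d → d < nextZero a j → G c - U (g c) = G d - U (g d) := by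
    intro c d hc hcd hd
    have h1 := (hac c d hc hcd hd).eq_add_intervalIntegral hcd (hint hc.le hcd hd.le hwi) (by
      filter_upwards [hder] with k hk hk'
      exact hk ⟨hc.trans_le hk'.1, hk'.2.trans_lt hd⟩) (right_mem_Icc.2 hcd)
    have h2 := hcov hc.le hcd hd.le (fun E => -Complex.I * v E)
    rw [← h2] at h1
    have hmm := left_mem_Icc.2 hmM.le
    have hgc := hmaps ⟨hc.le, hcd.trans hd.le⟩
    have hgd := hmaps ⟨hc.le.trans hcd, hd.le⟩
    have h3 := intervalIntegral.integral_add_adjacent_intervals (hwii m hmm _ hgc)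
      (hwii _ hgc _ hgd)
    rw [h1]
    simp only [hU]
    rw [← h3]
    ring
  obtain ⟨C, hC⟩ : ∃ C, ∀ k ∈ Icc (a j) (nextZero a j), G k - U (g k) = C := by
    obtain ⟨k₀, hk₀⟩ := nonempty_Ioo.2 hlt
    refine ⟨G k₀ - U (g k₀), ?_⟩
    have h1 : EqOn (fun k => G k - U (g k)) (fun _ => G k₀ - U (g k₀))
        (Ioo (a j) (nextZero a j)) := by
      intro k hk
      rcases le_total k k₀ with hle | hle
      · exact hstep k k₀ hk.1 hle hk₀.2
      · exact (hstep k₀ k hk₀.1 hle hk.2).symm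
    refine h1.of_subset_closure ?_ continuousOn_const Ioo_subset_Icc_self
      (by rw [closure_Ioo hlt.ne])
    exact hG.sub (hUc.comp h.differentiable.continuous.continuousOn hmaps)
  have hCa := hC _ (left_mem_Icc.2 hlt.le)
  have hCb := hC _ (right_mem_Icc.2 hlt.le)
  rw [hGa, zero_sub] at hCa
  rw [hGb, zero_sub] at hCb
  have hUm : U m = 0 := by simp [hU]
  have hC0 : C = 0 := by
    rcases min_choice (g (a j)) (g (nextZero a j)) with h1 | h1
    · rw [← hCa, ← h1, ← hm, hUm, neg_zero]
    · rw [← hCb, ← h1, ← hm, hUm, neg_zero]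
  have hUM : U M = 0 := by
    rw [hC0, neg_eq_zero] at hCa hCb
    rcases max_choice (g (a j)) (g (nextZero a j)) with h1 | h1
    · rw [hM, h1, hCa]
    · rw [hM, h1, hCb]
  refine (mem_neg_dirichletMomentum_graph hmM.le).2 ⟨U, hUac, ⟨hUm, hUM⟩, ?_, ?_⟩
  · apply hae
    filter_upwards [hu] with k hk hk'
    have h1 := hC k (Ioo_subset_Icc_self hk')
    rw [hC0, sub_eq_zero] at h1
    rw [← h1]
    exact hk hk'
  · filter_upwards [hwi'.ae_hasDerivAt_integral] with x hx hxm
    rw [← uIcc_of_le hmM.le] at hxm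
    exact hx hxm m left_mem_uIcc

/-- The inclusion `V T V⁻¹ ⊆ ⨁ (-P_j)`: in the energy variable, `f = g' y` becomes
`±√|g'| y`, which vanishes at the critical points of `g`. -/
theorem graph_timeOp_subset (h : CriticalPoints g a)
    {p : PiLp 2 (fun j => IntervalL2 (energyInterval g a j)) ×
      PiLp 2 (fun j => IntervalL2 (energyInterval g a j))}
    (hp : (h.unitary p.1, h.unitary p.2) ∈ (timeOp g).graph) :
    p ∈ (directSum fun j => -dirichletMomentum (energyInterval g a j)).graph := by
  obtain ⟨y, r, hy, hyb, hyr, hp1, hp2⟩ := h.mem_graph_timeOp.1 hp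
  obtain ⟨Y, ψ, hYp, hψp, hYc, hYac, hYd, hYy, hψr⟩ := exists_periodic_extension hy hyb hyr
  have hYy' : ∀ᵐ k ∂circleMeasure, Y k = y k := ae_circleMeasure_iff.2 (ae_of_all _ hYy)
  have hdd := h.deriv_deriv_periodic
  rw [mem_graph_directSum]
  intro j
  have hu : ∀ᵐ k, k ∈ Ioo (a j) (nextZero a j) →
      (√(2 * Real.pi * |deriv g k|) : ℂ) * p.1 j (g k) = ((deriv g k : ℝ) : ℂ) * Y k := by
    refine h.ae_Ioo_of_ae_circleMeasure j (fun k hk => ?_) ?_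
    · rwa [h.periodic.sub_eq, h.deriv_periodic.sub_eq, hYp.sub_eq] at hk
    · filter_upwards [hp1, h.coeFn_unitary p.1, hYy'] with k h1 h2 h3 hk
      rw [← h2 j hk, h3]
      exact h1
  have hv : ∀ᵐ k, k ∈ Ioo (a j) (nextZero a j) →
      (√(2 * Real.pi * |deriv g k|) : ℂ) * p.2 j (g k) =
        Complex.I / 2 * (deriv (deriv g) k / deriv g k * Y k) + Complex.I * ψ k := by
    refine h.ae_Ioo_of_ae_circleMeasure j (fun k hk => ?_) ?_
    · rwa [h.periodic.sub_eq, h.deriv_periodic.sub_eq, hYp.sub_eq, hψp.sub_eq, hdd.sub_eq] at hk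
    · filter_upwards [hp2, h.coeFn_unitary p.2, hYy', hψr] with k h1 h2 h3 h4 hk
      rw [← h2 j hk, h3, h4]
      refine h1.trans ?_
      linear_combination (-r k) * Complex.I_mul_I
  have hsqrt : ∀ k ∈ Ioo (a j) (nextZero a j), (√(2 * Real.pi * |deriv g k|) : ℂ) ≠ 0 := by
    intro k hk
    have := abs_pos.2 (h.deriv_ne_zero j hk)
    rw [Complex.ofReal_ne_zero]
    positivity
  have hss : ∀ k, (signedSqrt (deriv g k) : ℂ) * (√(2 * Real.pi * |deriv g k|) : ℂ) =
      ((deriv g k : ℝ) : ℂ) := fun k => by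
    rw [← Complex.ofReal_mul, signedSqrt_mul_sqrt]
  refine h.mem_graph_of_comp j (G := fun k => (signedSqrt (deriv g k) : ℂ) * Y k)
    ?_ ?_ ?_ ?_ ?_ ?_
  · exact ((Complex.continuous_ofReal.comp (continuous_signedSqrt.comp
      h.contDiff_deriv.continuous)).mul hYc).continuousOn
  · simp only [h.deriv_eq_zero, signedSqrt_zero, Complex.ofReal_zero, zero_mul]
  · simp only [h.deriv_nextZero, signedSqrt_zero, Complex.ofReal_zero, zero_mul]
  · intro c d hc hcd hd
    have h1 : ContDiffOn ℝ 1 (fun k => (signedSqrt (deriv g k) : ℂ)) (uIcc c d) := by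
      intro k hk
      rw [uIcc_of_le hcd] at hk
      have h0 := h.deriv_ne_zero j ⟨hc.trans_le hk.1, hk.2.trans_lt hd⟩
      exact (Complex.ofRealCLM.contDiff.contDiffAt.comp k
        ((contDiffAt_signedSqrt h0).comp k h.contDiff_deriv.contDiffAt)).contDiffWithinAt
    simpa using! h1.absolutelyContinuousOnInterval.smul (hYac c d)
  · filter_upwards [hv, hYd] with k h1 h2 hk
    have h0 := h.deriv_ne_zero j hk
    have h0' : ((deriv g k : ℝ) : ℂ) ≠ 0 := Complex.ofReal_ne_zero.2 h0
    have h3 := ((hasDerivAt_signedSqrt h0).comp k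
      (h.contDiff_deriv.differentiable one_ne_zero k).hasDerivAt).ofReal_comp
    refine (h3.mul h2).congr_deriv (mul_left_cancel₀ (hsqrt k hk) ?_)
    have h4 := h1 hk
    have h5 := hss k
    have h6 := hsqrt k hk
    have h7 : (√(2 * Real.pi * |deriv g k|) : ℂ) *
        (((deriv g k : ℝ) : ℂ) * (-Complex.I * p.2 j (g k))) =
        deriv (deriv g) k * Y k / 2 + deriv g k * ψ k := by
      have h8 : (√(2 * Real.pi * |deriv g k|) : ℂ) *
        (((deriv g k : ℝ) : ℂ) * (-Complex.I * p.2 j (g k))) =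
        ((deriv g k : ℝ) : ℂ) * (-Complex.I *
          ((√(2 * Real.pi * |deriv g k|) : ℂ) * p.2 j (g k))) := by ring
      rw [h8, h4]
      field_simp
      rw [Complex.I_sq]
      ring
    rw [h7]
    push_cast
    have h9 : (√(2 * Real.pi * |deriv g k|) : ℂ) *
        (1 / (2 * (√(2 * Real.pi * |deriv g k|) : ℂ))) = 1 / 2 := by
      field_simp
    simp only [Function.comp_apply]
    linear_combination (deriv (deriv g) k * Y k : ℂ) * h9 + ψ k * h5
  · filter_upwards [hu] with k h1 hk
    refine mul_left_cancel₀ (hsqrt k hk) ((h1 hk).trans ?_)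
    rw [← hss k]
    ring

end CriticalPoints

/-! ### Transported test functions lie in the domain of the time operator -/

namespace CriticalPoints

variable {g : ℝ → ℝ} {n : ℕ} {a : Fin n → ℝ}

/-- A test function `φ` of the energy gives the continuously differentiable function
`φ ∘ g / (±√|g'|)` on one branch; it vanishes near the critical points, where `φ ∘ g` does. -/
theorem exists_contDiff_comp_div (h : CriticalPoints g a) (j : Fin n) {φ : ℝ → ℂ} {m' M' : ℝ}
    (hm' : min (g (a j)) (g (nextZero a j)) < m') (hM' : M' < max (g (a j)) (g (nextZero a j)))
    (hφ : ContDiff ℝ 1 φ) (hφ0 : ∀ x ∉ Icc m' M', φ x = 0) :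
    ∃ y : ℝ → ℂ, ContDiff ℝ 1 y ∧ (∀ k ∉ Ioo (a j) (nextZero a j), y k = 0 ∧ deriv y k = 0) ∧
      ∀ k ∈ Ioo (a j) (nextZero a j), y k = φ (g k) / signedSqrt (deriv g k) ∧
        deriv y k = deriv φ (g k) * √(2 * Real.pi * |deriv g k|) -
          φ (g k) * deriv (deriv g) k /
            (2 * √(2 * Real.pi * |deriv g k|) * signedSqrt (deriv g k) ^ 2) := by
  set I := Ioo (a j) (nextZero a j) with hI
  set F : ℝ → ℂ := fun k => φ (g k) / signedSqrt (deriv g k) with hF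
  set y : ℝ → ℂ := I.indicator F with hy
  set S : Set ℝ := Icc (a j) (nextZero a j) ∩ g ⁻¹' Icc m' M' with hS
  have hSc : IsClosed S := isClosed_Icc.inter (isClosed_Icc.preimage h.differentiable.continuous)
  have hSI : S ⊆ I := by
    rintro k ⟨hk, hgk⟩
    refine ⟨lt_of_le_of_ne hk.1 ?_, lt_of_le_of_ne hk.2 ?_⟩
    · rintro rfl
      rcases le_total (g (a j)) (g (nextZero a j)) with h1 | h1
      · rw [min_eq_left h1] at hm'
        exact hm'.not_ge hgk.1
      · rw [max_eq_left h1] at hM'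
        exact hM'.not_ge hgk.2
    · rintro rfl
      rcases le_total (g (a j)) (g (nextZero a j)) with h1 | h1
      · rw [max_eq_right h1] at hM'
        exact hM'.not_ge hgk.2
      · rw [min_eq_right h1] at hm'
        exact hm'.not_ge hgk.1
  have hy0 : ∀ k ∉ S, y k = 0 := by
    intro k hk
    by_cases hkI : k ∈ I
    · have : g k ∉ Icc m' M' := fun hg => hk ⟨Ioo_subset_Icc_self hkI, hg⟩
      rw [hy, indicator_of_mem hkI, hF]
      simp only [hφ0 _ this, zero_div]
    · exact indicator_of_notMem hkI _
  have hyout : ∀ k ∉ S, y =ᶠ[𝓝 k] fun _ => 0 := fun k hk => by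
    filter_upwards [hSc.isOpen_compl.mem_nhds hk] with l hl using hy0 l hl
  have hyin : ∀ k ∈ I, y =ᶠ[𝓝 k] F := fun k hk => by
    filter_upwards [isOpen_Ioo.mem_nhds hk] with l hl using indicator_of_mem hl F
  refine ⟨y, ?_, fun k hk => ?_, fun k hk => ⟨indicator_of_mem hk F, ?_⟩⟩
  · rw [contDiff_iff_contDiffAt]
    intro k
    by_cases hk : k ∈ S
    · have h0 := h.deriv_ne_zero j (hSI hk)
      refine ContDiffAt.congr_of_eventuallyEq ?_ (hyin k (hSI hk))
      have h1 : ContDiffAt ℝ 1 (fun k => φ (g k)) k :=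
        (hφ.comp (h.contDiff.of_le (by norm_num))).contDiffAt
      have h2 : ContDiffAt ℝ 1 (fun k => (signedSqrt (deriv g k) : ℂ)) k :=
        Complex.ofRealCLM.contDiff.contDiffAt.comp k
          ((contDiffAt_signedSqrt h0).comp k h.contDiff_deriv.contDiffAt)
      simp only [hF, div_eq_mul_inv]
      exact h1.mul (h2.inv (Complex.ofReal_ne_zero.2 (signedSqrt_ne_zero h0)))
    · exact contDiffAt_const.congr_of_eventuallyEq (hyout k hk)
  · have hkS : k ∉ S := fun hkS => hk (hSI hkS)
    refine ⟨hy0 k hkS, ?_⟩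
    rw [(hyout k hkS).deriv_eq]
    simp
  · have h0 := h.deriv_ne_zero j hk
    have hs0 : (signedSqrt (deriv g k) : ℂ) ≠ 0 := Complex.ofReal_ne_zero.2 (signedSqrt_ne_zero h0)
    have h1 : HasDerivAt (fun k => φ (g k)) (deriv φ (g k) * ((deriv g k : ℝ) : ℂ)) k := by
      have := (hφ.differentiable one_ne_zero (g k)).hasDerivAt.scomp k
        (h.differentiable k).hasDerivAt
      rwa [Complex.real_smul, mul_comm] at this
    have h2 := ((hasDerivAt_signedSqrt h0).comp k
      (h.contDiff_deriv.differentiable one_ne_zero k).hasDerivAt).ofReal_comp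
    have h4 : HasDerivAt F _ k := h1.fun_div h2 hs0
    rw [(hyin k hk).deriv_eq, h4.deriv]
    have hR : (√(2 * Real.pi * |deriv g k|) : ℂ) ≠ 0 := by
      have := abs_pos.2 h0
      rw [Complex.ofReal_ne_zero]
      positivity
    have h3 : ((deriv g k : ℝ) : ℂ) =
        (signedSqrt (deriv g k) : ℂ) * (√(2 * Real.pi * |deriv g k|) : ℂ) := by
      rw [← Complex.ofReal_mul, signedSqrt_mul_sqrt]
    rw [h3]
    push_cast
    field_simp

/-- The unitary carries `(φ, i φ')`, for a test function `φ` on the `j`-th energy interval, into the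
graph of `T`. -/
theorem graph_timeOp_of_test (h : CriticalPoints g a) (j : Fin n)
    {u v : IntervalL2 (energyInterval g a j)} {φ : ℝ → ℂ} {m' M' : ℝ}
    (hm' : min (g (a j)) (g (nextZero a j)) < m') (hM' : M' < max (g (a j)) (g (nextZero a j)))
    (hφ : ContDiff ℝ 1 φ) (hφ0 : ∀ x ∉ Icc m' M', φ x = 0)
    (hu : u =ᵐ[volume.restrict (energyInterval g a j)] φ)
    (hv : v =ᵐ[volume.restrict (energyInterval g a j)] fun E => Complex.I * deriv φ E) :
    (h.unitary (WithLp.toLp 2 (Pi.single j u)), h.unitary (WithLp.toLp 2 (Pi.single j v))) ∈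
      (timeOp g).graph := by
  have hpi := Real.two_pi_pos
  obtain ⟨y₀, hy₀, hout, hin⟩ := h.exists_contDiff_comp_div j hm' hM' hφ hφ0
  have hdd := h.deriv_deriv_periodic
  -- the periodization of `y₀`, restricted to `[0, 2π]`
  set y : ℝ → ℂ := fun k => y₀ k + y₀ (k + 2 * Real.pi) with hy
  have hyC : ContDiff ℝ 1 y := hy₀.add (hy₀.comp (contDiff_id.add contDiff_const))
  have hdy : ∀ k, deriv y k = deriv y₀ k + deriv y₀ (k + 2 * Real.pi) := by
    intro k
    have hd := hy₀.differentiable one_ne_zero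
    have hd2 : DifferentiableAt ℝ (fun k => y₀ (k + 2 * Real.pi)) k :=
      (hd _).comp k (differentiableAt_id.add_const _)
    rw [hy, deriv_fun_add (hd k) hd2, deriv_comp_add_const]
  have hwidth : nextZero a j ≤ 2 * Real.pi + a j := by
    have h3 : a ⟨0, j.pos⟩ ≤ a j := h.strictMono.monotone (Fin.le_def.2 (Nat.zero_le _))
    linarith [h.nextZero_le j]
  have hyon : ∀ k ∈ branchSet a j, y k = φ (g k) / signedSqrt (deriv g k) ∧
      deriv y k = deriv φ (g k) * √(2 * Real.pi * |deriv g k|) -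
          φ (g k) * deriv (deriv g) k /
            (2 * √(2 * Real.pi * |deriv g k|) * signedSqrt (deriv g k) ^ 2) := by
    rintro k ⟨hk0, hk | hk⟩
    · have h1 := hout (k + 2 * Real.pi) (fun h' => by linarith [h'.2, hk.1])
      rw [hdy, h1.2, add_zero]
      simp only [hy]
      rw [h1.1, add_zero]
      exact hin k hk
    · have h1 := hout k (fun h' => by linarith [h'.1, hk.2])
      have h2 := hin _ hk
      rw [h.periodic, h.deriv_periodic, hdd] at h2
      rw [hdy, h1.2, zero_add]
      simp only [hy]
      rw [h1.1, zero_add]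
      exact h2
  have hyoff : ∀ k ∈ Ico 0 (2 * Real.pi), k ∉ branchSet a j → y k = 0 ∧ deriv y k = 0 := by
    intro k hk0 hk
    have h1 := hout k (fun h' => hk ⟨hk0, Or.inl h'⟩)
    have h2 := hout (k + 2 * Real.pi) (fun h' => hk ⟨hk0, Or.inr h'⟩)
    rw [hdy, h1.2, h2.2, add_zero]
    simp only [hy]
    rw [h1.1, h2.1, add_zero]
    simp
  have hrL : MemLp (fun k => -Complex.I * deriv y k) 2 circleMeasure :=
    memLp_circleMeasure_of_continuousOn
      (continuous_const.mul (hyC.continuous_deriv le_rfl)).continuousOn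
  have hcase : ∀ (u' : IntervalL2 (energyInterval g a j)) (θ : ℝ → ℂ) (ρ : ℝ → ℂ),
      u' =ᵐ[volume.restrict (energyInterval g a j)] θ →
      (∀ k ∈ branchSet a j, ρ k = √(2 * Real.pi * |deriv g k|) * θ (g k)) →
      (∀ k ∈ Ico 0 (2 * Real.pi), k ∉ branchSet a j → ρ k = 0) →
      h.unitary (WithLp.toLp 2 (Pi.single j u')) =ᵐ[circleMeasure] ρ := by
    intro u' θ ρ hu' hon hoff
    have hb : ∀ i, ∀ᵐ k ∂volume.restrict (branchSet a i),
        h.unitary (WithLp.toLp 2 (Pi.single j u')) k = ρ k := by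
      intro i
      by_cases hij : i = j
      · subst hij
        filter_upwards [(h.isBranch i).ae_restrict_of_ae_circleMeasure (h.coeFn_unitary _),
          (h.isBranch i).quasiMeasurePreserving.ae hu',
          ae_restrict_mem (h.isBranch i).measurableSet] with k h1 h2 h3
        rw [h1 i h3, hon k h3, ← h2]
        simp
      · filter_upwards [(h.isBranch i).ae_restrict_of_ae_circleMeasure (h.coeFn_unitary
            (WithLp.toLp 2 (Pi.single j u'))),
          (h.isBranch i).quasiMeasurePreserving.ae (Lp.coeFn_zero ℂ 2 _),
          ae_restrict_mem (h.isBranch i).measurableSet] with k h1 h2 h3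
        rw [h1 i h3, hoff k h3.1 (disjoint_left.1 (h.disjoint_branchSet hij) h3)]
        have h4 : (Pi.single j u' : ∀ j, IntervalL2 (energyInterval g a j)) i = 0 :=
          Pi.single_eq_of_ne hij _
        rw [h4, h2, Pi.zero_apply, mul_zero]
    exact ae_circleMeasure_of_forall_branch h.isBranch h.ae_exists_mem_branchSet hb
  have hne : ∀ k ∈ branchSet a j, (signedSqrt (deriv g k) : ℂ) ≠ 0 ∧
      (√(2 * Real.pi * |deriv g k|) : ℂ) ≠ 0 ∧ ((deriv g k : ℝ) : ℂ) =
        (signedSqrt (deriv g k) : ℂ) * (√(2 * Real.pi * |deriv g k|) : ℂ) := fun k hk =>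
    ⟨Complex.ofReal_ne_zero.2 (signedSqrt_ne_zero ((h.isBranch j).deriv_ne_zero k hk)),
      (h.isBranch j).sqrt_ne_zero hk, by rw [← Complex.ofReal_mul, signedSqrt_mul_sqrt]⟩
  refine h.mem_graph_timeOp.2 ⟨y, hrL.toLp _,
    absolutelyContinuousOnInterval_of_contDiff hyC _ _, ?_, ?_, ?_, ?_⟩
  · have h1 := hout 0 (fun h' => by linarith [h'.1, (h.mem_Ico j).1])
    have h2 := hout (2 * Real.pi + 2 * Real.pi) (fun h' => by linarith [h'.2, h.nextZero_lt j])
    simp only [hy]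
    rw [h1.1, h2.1, zero_add, zero_add, add_zero]
  · filter_upwards [hrL.coeFn_toLp] with k hk
    refine (hyC.differentiable one_ne_zero k).hasDerivAt.congr_deriv ?_
    rw [hk]
    linear_combination deriv y k * Complex.I_mul_I
  · refine hcase u φ _ hu (fun k hk => ?_) (fun k hk0 hk => ?_)
    · obtain ⟨h1, h2, h3⟩ := hne k hk
      rw [(hyon k hk).1, h3]
      field_simp
    · rw [(hyoff k hk0 hk).1, mul_zero]
  · have h1 : h.unitary (WithLp.toLp 2 (Pi.single j v)) =ᵐ[circleMeasure] fun k =>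
        Complex.I / 2 * (deriv (deriv g) k / deriv g k * y k) - -Complex.I * deriv y k := by
      refine hcase v _ _ hv (fun k hk => ?_) (fun k hk0 hk => ?_)
      · obtain ⟨h1, h2, h3⟩ := hne k hk
        rw [(hyon k hk).1, (hyon k hk).2, h3]
        field_simp
        ring
      · rw [(hyoff k hk0 hk).1, (hyoff k hk0 hk).2]
        ring
    refine h1.trans ?_
    filter_upwards [hrL.coeFn_toLp] with k hk
    rw [hk]

end CriticalPoints

/-! ### Closure, deficiency spaces and self-adjoint extension -/

/-- The graph of `-P` on `[m, M]` consists of the pairs `(-i ∫_m^x w, w)` with `w` of mean zero,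
so it is cut out by continuous conditions. -/
theorem isClosed_neg_dirichletMomentum_graph {m M : ℝ} (hmM : m ≤ M) :
    IsClosed ((-dirichletMomentum (Icc m M)).graph :
      Set (IntervalL2 (Icc m M) × IntervalL2 (Icc m M))) := by
  have h : ((-dirichletMomentum (Icc m M)).graph :
      Set (IntervalL2 (Icc m M) × IntervalL2 (Icc m M))) =
      {p | p.1 = volterra hmM (-Complex.I • p.2) ∧ ⟪expLp m M 0, p.2⟫_ℂ = 0} := by
    ext p
    refine ⟨fun hp => eq_volterra_of_mem_graph hmM hp, fun ⟨h1, h2⟩ => ?_⟩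
    have hi := (intervalIntegrable_of_Lp hmM p.2).const_mul (-Complex.I)
    refine (mem_neg_dirichletMomentum_graph hmM).2 ⟨fun x => ∫ t in m..x, -Complex.I * p.2 t,
      absolutelyContinuousOnInterval_intervalIntegral hi left_mem_uIcc, ⟨by simp, ?_⟩, ?_, ?_⟩
    · rw [inner_expLp hmM] at h2
      change ∫ t in m..M, -Complex.I * p.2 t = 0
      rw [intervalIntegral.integral_const_mul]
      simpa using h2
    · rw [h1]
      filter_upwards [coeFn_volterra hmM (-Complex.I • p.2), ae_restrict_mem measurableSet_Icc]
        with x h1 hx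
      rw [h1]
      refine intervalIntegral.integral_congr_ae ?_
      filter_upwards [(ae_restrict_iff' measurableSet_Icc).1 (Lp.coeFn_smul (-Complex.I) p.2)]
        with t h1 h2
      rw [uIoc_of_le hx.1] at h2
      rw [h1 ⟨h2.1.le, h2.2.trans hx.2⟩, Pi.smul_apply, smul_eq_mul]
    · filter_upwards [hi.ae_hasDerivAt_integral] with x hx hxm
      rw [← uIcc_of_le hmM] at hxm
      exact hx hxm m left_mem_uIcc
  rw [h]
  exact (isClosed_eq (by fun_prop) (by fun_prop)).inter (isClosed_eq (by fun_prop) (by fun_prop))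

theorem sum_toLp_single {ι : Type*} [Fintype ι] [DecidableEq ι] {H : ι → Type*}
    [∀ j, NormedAddCommGroup (H j)] (x : PiLp 2 H) :
    ∑ j, WithLp.toLp 2 (Pi.single j (x j)) = x := by
  ext i
  rw [WithLp.ofLp_sum, Finset.sum_apply]
  simp only
  rw [Finset.sum_pi_single]
  simp

section DirectSum

variable {ι : Type*} [Fintype ι] {H : ι → Type*} [∀ j, NormedAddCommGroup (H j)]
  [∀ j, InnerProductSpace ℂ (H j)] {A : ∀ j, H j →ₗ.[ℂ] H j}

theorem isClosed_directSum_graph (hA : ∀ j, IsClosed ((A j).graph : Set (H j × H j))) :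
    IsClosed ((directSum A).graph : Set (PiLp 2 H × PiLp 2 H)) := by
  have h : ((directSum A).graph : Set (PiLp 2 H × PiLp 2 H)) =
      ⋂ j, (fun p : PiLp 2 H × PiLp 2 H => (p.1 j, p.2 j)) ⁻¹' (A j).graph := by
    ext p
    simp only [mem_iInter]
    exact mem_graph_directSum
  rw [h]
  exact isClosed_iInter fun j => (hA j).preimage (by fun_prop)

theorem dense_directSum_domain (hA : ∀ j, Dense ((A j).domain : Set (H j))) :
    Dense ((directSum A).domain : Set (PiLp 2 H)) := by
  intro x
  have h := dense_pi univ (fun j _ => hA j) (WithLp.ofLp x)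
  exact map_mem_closure (PiLp.continuous_toLp 2 H) h fun y hy j => hy j (mem_univ j)

variable [DecidableEq ι]

theorem mem_graph_directSum_single {j : ι} {p : H j × H j} (hp : p ∈ (A j).graph) :
    (WithLp.toLp 2 (Pi.single j p.1), WithLp.toLp 2 (Pi.single j p.2)) ∈
      (directSum A).graph := by
  rw [mem_graph_directSum]
  intro i
  by_cases hij : i = j
  · subst hij
    simpa using hp
  · simp only [Pi.single_eq_of_ne hij]
    exact Submodule.zero_mem _

/-- The kernel condition for the adjoint of a direct sum decouples into its components. -/
theorem forall_directSum_graph_iff {x : PiLp 2 H} {z : ℂ} :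
    (∀ p ∈ (directSum A).graph, ⟪x, p.2⟫_ℂ = ⟪z • x, p.1⟫_ℂ) ↔
      ∀ j, ∀ p ∈ (A j).graph, ⟪x j, p.2⟫_ℂ = ⟪z • x j, p.1⟫_ℂ := by
  constructor
  · intro h j p hp
    have h1 := h _ (mem_graph_directSum_single hp)
    rw [PiLp.inner_apply, PiLp.inner_apply, Finset.sum_eq_single j, Finset.sum_eq_single j] at h1
    · simpa [inner_smul_left, mul_comm] using h1
    · intro i _ hij
      simp [Pi.single_eq_of_ne hij]
    · exact fun h => absurd (Finset.mem_univ j) h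
    · intro i _ hij
      simp [Pi.single_eq_of_ne hij]
    · exact fun h => absurd (Finset.mem_univ j) h
  · intro h p hp
    rw [PiLp.inner_apply, PiLp.inner_apply]
    exact Finset.sum_congr rfl fun j _ => h j _ (mem_graph_directSum.1 hp j)

end DirectSum

namespace CriticalPoints

variable {g : ℝ → ℝ} {n : ℕ} {a : Fin n → ℝ}

theorem single_mem_graph_timeOp (h : CriticalPoints g a) (j : Fin n)
    {p : IntervalL2 (energyInterval g a j) × IntervalL2 (energyInterval g a j)}
    (hp : p ∈ testGraph (energyInterval g a j) (min (g (a j)) (g (nextZero a j)))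
      (max (g (a j)) (g (nextZero a j)))) :
    (h.unitary (WithLp.toLp 2 (Pi.single j p.1)), h.unitary (WithLp.toLp 2 (Pi.single j p.2))) ∈
      (timeOp g).graph := by
  obtain ⟨φ, m', M', h1, h2, h3, h4, h5, h6⟩ := hp
  exact h.graph_timeOp_of_test j h1 h2 h3 h4 h5 h6

theorem continuous_unitary_single (h : CriticalPoints g a) (j : Fin n) :
    Continuous fun u : IntervalL2 (energyInterval g a j) =>
      h.unitary (WithLp.toLp 2 (Pi.single j u)) := by
  have hsingle : Continuous fun u : IntervalL2 (energyInterval g a j) =>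
      (Pi.single j u : ∀ i, IntervalL2 (energyInterval g a i)) :=
    continuous_single (A := fun i => IntervalL2 (energyInterval g a i)) j
  exact h.unitary.continuous.comp ((PiLp.continuous_toLp 2 _).comp hsingle)

theorem single_mem_closure_graph_timeOp (h : CriticalPoints g a) (j : Fin n)
    {p : IntervalL2 (energyInterval g a j) × IntervalL2 (energyInterval g a j)}
    (hp : p ∈ (-dirichletMomentum (energyInterval g a j)).graph) :
    (h.unitary (WithLp.toLp 2 (Pi.single j p.1)), h.unitary (WithLp.toLp 2 (Pi.single j p.2))) ∈
      (timeOp g).graph.topologicalClosure := by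
  have hcore : ((-dirichletMomentum (energyInterval g a j)).graph :
      Set (IntervalL2 (energyInterval g a j) × IntervalL2 (energyInterval g a j))) ⊆
      closure (testGraph (energyInterval g a j) (min (g (a j)) (g (nextZero a j)))
        (max (g (a j)) (g (nextZero a j)))) := by
    rw [h.energyInterval_eq j]
    exact fun q hq => graph_subset_closure_testGraph (h.image_endpoints_lt j) hq
  have hs := h.continuous_unitary_single j
  have hc : Continuous fun q : IntervalL2 (energyInterval g a j) ×
      IntervalL2 (energyInterval g a j) =>
        (h.unitary (WithLp.toLp 2 (Pi.single j q.1)),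
          h.unitary (WithLp.toLp 2 (Pi.single j q.2))) :=
    (hs.comp continuous_fst).prodMk (hs.comp continuous_snd)
  have hmap := map_mem_closure (t := ((timeOp g).graph : Set (CircleL2 × CircleL2))) hc (hcore hp)
    fun q hq => h.single_mem_graph_timeOp j hq
  exact hmap

/-- The unitary maps the graph of `⨁ (-P_j)` onto the closure of the graph of `T`. -/
theorem mem_closure_graph_timeOp_iff (h : CriticalPoints g a)
    {p : PiLp 2 (fun j => IntervalL2 (energyInterval g a j)) ×
      PiLp 2 (fun j => IntervalL2 (energyInterval g a j))} :
    (h.unitary p.1, h.unitary p.2) ∈ (timeOp g).graph.topologicalClosure ↔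
      p ∈ (directSum fun j => -dirichletMomentum (energyInterval g a j)).graph := by
  constructor
  · intro hp
    have hclosed : IsClosed ((directSum fun j =>
        -dirichletMomentum (energyInterval g a j)).graph :
        Set (PiLp 2 (fun j => IntervalL2 (energyInterval g a j)) ×
          PiLp 2 (fun j => IntervalL2 (energyInterval g a j)))) := by
      refine isClosed_directSum_graph fun j => ?_
      rw [h.energyInterval_eq j]
      exact isClosed_neg_dirichletMomentum_graph (h.image_endpoints_lt j).le
    have hc : Continuous fun q : CircleL2 × CircleL2 =>
      (h.unitary.symm q.1, h.unitary.symm q.2) := by fun_prop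
    have h1 := closure_minimal (fun q hq => h.graph_timeOp_subset
      (p := (h.unitary.symm q.1, h.unitary.symm q.2)) (by simpa using hq))
      (hclosed.preimage hc) hp
    simpa using h1
  · intro hp
    rw [mem_graph_directSum] at hp
    have h2 := Submodule.sum_mem _ fun j (_ : j ∈ Finset.univ) =>
      h.single_mem_closure_graph_timeOp j (hp j)
    have h3 : ∑ j, (h.unitary (WithLp.toLp 2 (Pi.single j (p.1 j))),
        h.unitary (WithLp.toLp 2 (Pi.single j (p.2 j)))) = (h.unitary p.1, h.unitary p.2) := by
      apply Prod.ext
      · simp only [Prod.fst_sum, ← map_sum, sum_toLp_single]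
      · simp only [Prod.snd_sum, ← map_sum, sum_toLp_single]
    rwa [h3] at h2

/-- Periodic boundary conditions on all energy intervals give a self-adjoint operator. -/
theorem basicCriterion (h : CriticalPoints g a) :
    SatisfiesBasicCriterion (conj h.unitary
      (directSum fun j => -intervalPeriodicMomentum (energyInterval g a j))) := by
  refine (SatisfiesBasicCriterion.directSum fun j => ?_).conj h.unitary
  rw [h.energyInterval_eq j]
  exact intervalPeriodicMomentum_basicCriterion (h.image_endpoints_lt j)

theorem timeOp_le (h : CriticalPoints g a) :
    timeOp g ≤ conj h.unitary
      (directSum fun j => -intervalPeriodicMomentum (energyInterval g a j)) := by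
  refine LinearPMap.le_of_le_graph fun p hp => ?_
  rw [mem_graph_conj, mem_graph_directSum]
  intro j
  have h1 := mem_graph_directSum.1 (h.graph_timeOp_subset
    (p := (h.unitary.symm p.1, h.unitary.symm p.2)) (by simpa using hp)) j
  refine (?_ : (-dirichletMomentum (energyInterval g a j)).graph ≤
    (-intervalPeriodicMomentum (energyInterval g a j)).graph) h1
  rw [h.energyInterval_eq j]
  exact dirichletMomentum_le_intervalPeriodicMomentum (h.image_endpoints_lt j).le

theorem dense_timeOp_domain (h : CriticalPoints g a) :
    Dense ((timeOp g).domain : Set CircleL2) := by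
  have hd : Dense ((directSum fun j => -dirichletMomentum (energyInterval g a j)).domain :
      Set (PiLp 2 fun j => IntervalL2 (energyInterval g a j))) := by
    refine dense_directSum_domain fun j => ?_
    rw [h.energyInterval_eq j]
    exact dense_dirichletMomentum_domain (h.image_endpoints_lt j).le
  intro f
  rw [← closure_closure, ← h.unitary.apply_symm_apply f]
  refine map_mem_closure h.unitary.continuous (hd (h.unitary.symm f)) fun x hx => ?_
  obtain ⟨w, hw⟩ := LinearPMap.mem_domain_iff.1 hx
  exact map_mem_closure (f := Prod.fst) (t := ((timeOp g).domain : Set CircleL2))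
    continuous_fst (h.mem_closure_graph_timeOp_iff.2 hw)
    fun q hq => LinearPMap.mem_domain_of_mem_graph (y := q.2) hq

theorem isSymmetricOp_timeOp (h : CriticalPoints g a) : IsSymmetricOp (timeOp g) := by
  refine ⟨h.dense_timeOp_domain, LinearPMap.IsFormalAdjoint.le_adjoint h.dense_timeOp_domain ?_⟩
  intro x y
  exact h.basicCriterion.symm _ (LinearPMap.le_graph_of_le h.timeOp_le ((timeOp g).mem_graph x)) _
    (LinearPMap.le_graph_of_le h.timeOp_le ((timeOp g).mem_graph y))

theorem isClosable_timeOp (h : CriticalPoints g a) : (timeOp g).IsClosable :=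
  h.basicCriterion.isSelfAdjoint.isClosed.isClosable.leIsClosable h.timeOp_le

theorem conj_closure_timeOp (h : CriticalPoints g a) :
    conj h.unitary.symm (timeOp g).closure =
      directSum fun j => -dirichletMomentum (energyInterval g a j) := by
  apply LinearPMap.eq_of_eq_graph
  ext p
  rw [mem_graph_conj, LinearIsometryEquiv.symm_symm,
    ← h.isClosable_timeOp.graph_closure_eq_closure_graph, h.mem_closure_graph_timeOp_iff]

theorem mem_kerSub_adjoint_timeOp_iff (h : CriticalPoints g a) {z : ℂ} {x : CircleL2} :
    x ∈ kerSub (timeOp g)† z ↔ ∀ j, ∀ p ∈ (-dirichletMomentum (energyInterval g a j)).graph,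
      ⟪h.unitary.symm x j, p.2⟫_ℂ = ⟪z • h.unitary.symm x j, p.1⟫_ℂ := by
  rw [mem_kerSub_adjoint_iff h.dense_timeOp_domain, ← forall_directSum_graph_iff]
  constructor
  · intro hx p hp
    have h1 := hx _ (h.mem_closure_graph_timeOp_iff.2 hp)
    simp only at h1
    rwa [← h.unitary.symm.inner_map_map, ← h.unitary.symm.inner_map_map, map_smul,
      h.unitary.symm_apply_apply, h.unitary.symm_apply_apply] at h1
  · intro hx p hp
    have h1 := hx (h.unitary.symm p.1, h.unitary.symm p.2)
      (h.mem_closure_graph_timeOp_iff.1 (by simpa using hp))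
    rwa [← map_smul, h.unitary.symm.inner_map_map, h.unitary.symm.inner_map_map] at h1

/-- The deficiency space `ker (T* - i c)` is the image under the unitary of
`⨁ ℂ e^{cE}`, hence `n`-dimensional. -/
theorem rank_kerSub_adjoint_timeOp (h : CriticalPoints g a) (c : ℝ) :
    Module.rank ℂ (kerSub (timeOp g)† (c * Complex.I)) = n := by
  have hex : ∀ j, ∃ e : IntervalL2 (energyInterval g a j), e ≠ 0 ∧
      ∀ x, x ∈ Submodule.span ℂ {e} ↔
        ∀ p ∈ (-dirichletMomentum (energyInterval g a j)).graph,
          ⟪x, p.2⟫_ℂ = ⟪(c * Complex.I) • x, p.1⟫_ℂ := by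
    intro j
    rw [h.energyInterval_eq j]
    exact ⟨_, expLp_ne_zero (h.image_endpoints_lt j) c,
      mem_span_expLp_iff (h.image_endpoints_lt j).le c⟩
  choose e he0 he using hex
  let L : (Fin n → ℂ) →ₗ[ℂ] CircleL2 :=
    { toFun := fun b => h.unitary (WithLp.toLp 2 fun j => b j • e j)
      map_add' := fun b b' => by
        rw [← map_add, ← WithLp.toLp_add]
        congr 2
        exact funext fun j => add_smul _ _ _
      map_smul' := fun r b => by
        rw [RingHom.id_apply, ← map_smul, ← WithLp.toLp_smul]
        congr 2
        exact funext fun j => mul_smul r (b j) (e j) }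
  have hLinj : Function.Injective L := by
    intro b b' hbb
    have h1 := h.unitary.injective hbb
    funext j
    have h2 : b j • e j = b' j • e j := congrFun ((WithLp.toLp_injective 2) h1) j
    exact smul_left_injective ℂ (he0 j) h2
  have hrange : kerSub (timeOp g)† (c * Complex.I) = LinearMap.range L := by
    ext x
    rw [h.mem_kerSub_adjoint_timeOp_iff, LinearMap.mem_range]
    simp only [← he, Submodule.mem_span_singleton]
    constructor
    · intro hx
      choose b hb using hx
      refine ⟨b, ?_⟩
      change h.unitary (WithLp.toLp 2 fun j => b j • e j) = x
      rw [← h.unitary.apply_symm_apply x]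
      congr 1
      exact PiLp.ext hb
    · rintro ⟨b, rfl⟩ j
      refine ⟨b j, ?_⟩
      change _ = h.unitary.symm (h.unitary (WithLp.toLp 2 fun j => b j • e j)) j
      rw [h.unitary.symm_apply_apply]
  rw [hrange, rank_range_of_injective L hLinj, rank_fin_fun]

end CriticalPoints

end TimeOperator

theorem mainTheorem5 (g : ℝ → ℝ) (hg : ContDiff ℝ 2 g)
    (hper : Function.Periodic g (2 * Real.pi)) (n : ℕ) (a : Fin n → ℝ) (ha : StrictMono a)
    (hzeros : {k : ℝ | k ∈ Set.Ico 0 (2 * Real.pi) ∧ deriv g k = 0} = Set.range a) :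
    TimeOperator.IsSymmetricOp (TimeOperator.timeOp g) ∧
    (TimeOperator.timeOp g).IsClosable ∧
    (∃ V : TimeOperator.CircleL2 ≃ₗᵢ[ℂ]
        PiLp 2 (fun j : Fin n => TimeOperator.IntervalL2 (TimeOperator.energyInterval g a j)),
      TimeOperator.conj V (TimeOperator.timeOp g).closure =
        TimeOperator.directSum
          (fun j => -TimeOperator.dirichletMomentum (TimeOperator.energyInterval g a j)) ∧
      TimeOperator.conj V (TimeOperator.mulOp TimeOperator.circleMeasure g) =
        TimeOperator.directSum
          (fun j => TimeOperator.mulOp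
            (MeasureTheory.volume.restrict (TimeOperator.energyInterval g a j))
            (fun E => E))) ∧
    TimeOperator.deficiencyPlus (TimeOperator.timeOp g) = (n : Cardinal) ∧
    TimeOperator.deficiencyMinus (TimeOperator.timeOp g) = (n : Cardinal) ∧
    ∃ S : TimeOperator.CircleL2 →ₗ.[ℂ] TimeOperator.CircleL2,
      TimeOperator.timeOp g ≤ S ∧ IsSelfAdjoint S := by
  have h : TimeOperator.CriticalPoints g a := ⟨hg, hper, ha, hzeros⟩
  refine ⟨h.isSymmetricOp_timeOp, h.isClosable_timeOp, ⟨h.unitary.symm, h.conj_closure_timeOp,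
    TimeOperator.conj_branchUnitary_symm_mulOp _ _ _⟩, ?_, ?_, _, h.timeOp_le,
    h.basicCriterion.isSelfAdjoint⟩
  · have h1 := h.rank_kerSub_adjoint_timeOp 1
    rwa [Complex.ofReal_one, one_mul] at h1
  · have h1 := h.rank_kerSub_adjoint_timeOp (-1)
    rwa [Complex.ofReal_neg, Complex.ofReal_one, neg_one_mul] at h1
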